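/- **Theorem 4.3 (Comparison Principle).** Let $n\ge 2$, $k\in\{1,\dots,n-1\}$, $L\ge 1$, and let $K\subset\mathbb{R}^n$ be compact. For $p\in\mathbb{R}^n$ and $M$ in the space $\mathbb{S}^n$ of symmetric real $n\times n$ matrices set $$F(p,M):=\inf\Big\{-\tfrac12\mathrm{tr}(Ma):\ a\succeq 0,\ ap=0,\ \lambda_{(n-k)}(a)\ge 1,\ \lambda_{(1)}(a)\le L\Big\},$$ where $a$ ranges over symmetric matrices and $\lambda_{(i)}(a)$ is the $i$-th largest eigenvalue of $a$. For a locally bounded real function $f$ on a set $D$, let $f^*(x)=\lim_{\varepsilon\downarrow0}\sup_{y\in D,\,|y-x|<\varepsilon}f(y)$ and $f_*(x)=\lim_{\varepsilon\downarrow0}\inf_{y\in D,\,|y-x|<\varepsilon}f(y)$, $x\in D$ (with $D=K$ for functions on $K$ and $D=\mathbb{R}^n\times\mathbb{S}^n$ for $F$). A bounded $u:K\to\mathbb{R}$ is a *viscosity subsolution* of $F(\nabla u,\nabla^2u)=1$ on $K$ if $$F_*(\nabla\varphi(x),\nabla^2\varphi(x))\le 1\qquad(1)$$ for all $x$ in the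 interior of $K$ and all $\varphi\in C^2(\mathbb{R}^n)$ with $(u^*-\varphi)(x)=\max_K(u^*-\varphi)$; it satisfies the *zero boundary condition* if (1) also holds for all $x\in\partial K$ with $u^*(x)>0$ and all such $\varphi$. A bounded $w:K\to\mathbb{R}$ is a *viscosity supersolution* of $F(\nabla w,\nabla^2w)=1$ on $K$ if $$F^*(\nabla\varphi(x),\nabla^2\varphi(x))\ge 1\qquad(2)$$ for all $x$ in the interior of $K$ and all $\varphi\in C^2(\mathbb{R}^n)$ with $(w_*-\varphi)(x)=\min_K(w_*-\varphi)$; it satisfies the *zero boundary condition* if (2) also holds for all $x\in\partial K$ with $w_*(x)<0$ and all such $\varphi$. Suppose that there are maps $T_\iota:\mathbb{R}^n\to\mathbb{R}^n$, $\iota\in(1,2]$, each a composition of a rotation, a dilation (by a positive factor) and a translation, such that $K$ is contained in the interior of $T_\iota(K)$ for every $\iota\in(1,2]$ and $\lim_{\iota\downarrow1}T_\iota(x)=x$ for every $x\in\mathbb{R}^n$. Then, for every upper semicontinuous viscosity subsolution $u$ of $F(\nabla u,\nabla^2u)=1$ on $K$ satisfying the zero boundary condition and every lower semicontinuous viscosity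 supersolution $w$ of $F(\nabla w,\nabla^2w)=1$ on $K$ satisfying the zero boundary condition, $u\le w^*$ on $K$. -/

import Mathlib

open Set Filter Topology

noncomputable section

namespace ViscComparison

/-- Euclidean space `ℝⁿ`. -/
abbrev E (n : ℕ) := EuclideanSpace ℝ (Fin n)

/-- The upper semicontinuous envelope at `x` of a function on the set `s`:
`lim_{ε ↓ 0} sup {f y : y ∈ s, |y - x| < ε}` (used for `x ∈ s` and `f` locally bounded on `s`). -/
def upperEnv {X : Type*} [TopologicalSpace X] (s : Set X) (f : X → ℝ) (x : X) : ℝ :=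
  limsup f (𝓝[s] x)

/-- The lower semicontinuous envelope at `x` of a function on the set `s`:
`lim_{ε ↓ 0} inf {f y : y ∈ s, |y - x| < ε}` (used for `x ∈ s` and `f` locally bounded on `s`). -/
def lowerEnv {X : Type*} [TopologicalSpace X] (s : Set X) (f : X → ℝ) (x : X) : ℝ :=
  liminf f (𝓝[s] x)

/-- `λ_(i)(a)`, the `i`-th largest eigenvalue (with multiplicity, `1 ≤ i ≤ n`) of a
symmetric real `n × n` matrix `a`. -/
def ordEig {n : ℕ} (i : ℕ) (a : Matrix (Fin n) (Fin n) ℝ) : ℝ :=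
  open Classical in
  if h : a.IsHermitian ∧ 1 ≤ i ∧ i ≤ n then
    h.1.eigenvalues₀ ⟨i - 1, by rw [Fintype.card_fin]; omega⟩
  else 0

/-- The matrices over which the infimum in `F(p, M)` is taken:
`a ⪰ 0`, `a p = 0`, `λ_(n-k)(a) ≥ 1`, `λ_(1)(a) ≤ L`. -/
def admissible (n k : ℕ) (L : ℝ) (p : E n) : Set (Matrix (Fin n) (Fin n) ℝ) :=
  {a | a.PosSemidef ∧ a.mulVec p.ofLp = 0 ∧ 1 ≤ ordEig (n - k) a ∧ ordEig 1 a ≤ L}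

/-- `F(p, M) = inf {-½ tr(M a) : a ⪰ 0, a p = 0, λ_(n-k)(a) ≥ 1, λ_(1)(a) ≤ L}`,
as a function of the pair `(p, M)`. -/
def F (n k : ℕ) (L : ℝ) (q : E n × Matrix (Fin n) (Fin n) ℝ) : ℝ :=
  sInf ((fun a => -(1 / 2 : ℝ) * (q.2 * a).trace) '' admissible n k L q.1)

/-- `ℝⁿ × 𝕊ⁿ`, the domain of `F`: the second component is a symmetric matrix. -/
def symDomain (n : ℕ) : Set (E n × Matrix (Fin n) (Fin n) ℝ) :=
  {q | q.2.IsSymm}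

/-- The Hessian matrix of `φ` at `x`. -/
def hessian {n : ℕ} (φ : E n → ℝ) (x : E n) : Matrix (Fin n) (Fin n) ℝ :=
  Matrix.of fun i j =>
    fderiv ℝ (fderiv ℝ φ) x (EuclideanSpace.single i 1) (EuclideanSpace.single j 1)

/-- `F_*(∇φ(x), ∇²φ(x)) ≤ 1` for every `φ ∈ C²(ℝⁿ)` such that `u^* - φ` attains its maximum
over `K` at `x`. -/
def SubTestAt {n : ℕ} (k : ℕ) (L : ℝ) (K : Set (E n)) (u : E n → ℝ) (x : E n) : Prop :=
  ∀ φ : E n → ℝ, ContDiff ℝ 2 φ → IsMaxOn (fun y => upperEnv K u y - φ y) K x →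
    lowerEnv (symDomain n) (F n k L) (gradient φ x, hessian φ x) ≤ 1

/-- `F^*(∇φ(x), ∇²φ(x)) ≥ 1` for every `φ ∈ C²(ℝⁿ)` such that `w_* - φ` attains its minimum
over `K` at `x`. -/
def SuperTestAt {n : ℕ} (k : ℕ) (L : ℝ) (K : Set (E n)) (w : E n → ℝ) (x : E n) : Prop :=
  ∀ φ : E n → ℝ, ContDiff ℝ 2 φ → IsMinOn (fun y => lowerEnv K w y - φ y) K x →
    1 ≤ upperEnv (symDomain n) (F n k L) (gradient φ x, hessian φ x)

/-- `u` is bounded on `K`. -/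
def BoundedOn {n : ℕ} (K : Set (E n)) (u : E n → ℝ) : Prop :=
  ∃ C : ℝ, ∀ x ∈ K, |u x| ≤ C

/-- Viscosity subsolution of `F(∇u, ∇²u) = 1` in the interior of `K`. A function on `K` is
represented by a function on `ℝⁿ`, of which only the values on `K` matter. -/
def IsViscSubsolution {n : ℕ} (k : ℕ) (L : ℝ) (K : Set (E n)) (u : E n → ℝ) : Prop :=
  BoundedOn K u ∧ ∀ x ∈ interior K, SubTestAt k L K u x

/-- The zero boundary condition for subsolutions. -/
def SubZeroBoundary {n : ℕ} (k : ℕ) (L : ℝ) (K : Set (E n)) (u : E n → ℝ) : Prop :=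
  ∀ x ∈ frontier K, 0 < upperEnv K u x → SubTestAt k L K u x

/-- Viscosity supersolution of `F(∇w, ∇²w) = 1` in the interior of `K`. -/
def IsViscSupersolution {n : ℕ} (k : ℕ) (L : ℝ) (K : Set (E n)) (w : E n → ℝ) : Prop :=
  BoundedOn K w ∧ ∀ x ∈ interior K, SuperTestAt k L K w x

/-- The zero boundary condition for supersolutions. -/
def SuperZeroBoundary {n : ℕ} (k : ℕ) (L : ℝ) (K : Set (E n)) (w : E n → ℝ) : Prop :=
  ∀ x ∈ frontier K, lowerEnv K w x < 0 → SuperTestAt k L K w x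

/-- `T` is a composition of a rotation `R` (a linear isometry of determinant `1`), a dilation
by a factor `c > 0` and a translation by `b`; composing them in another order gives maps of
the same form. -/
def IsRotDilTrans {n : ℕ} (T : E n → E n) : Prop :=
  ∃ (R : E n ≃ₗᵢ[ℝ] E n) (c : ℝ) (b : E n),
    LinearMap.det (R.toLinearEquiv : E n →ₗ[ℝ] E n) = 1 ∧ 0 < c ∧ ∀ x, T x = c • R x + b

end ViscComparison

end

/-! The operator does not depend on the base point, and it satisfies `F (t R p, s R M Rᵀ) = s F (p,
M)` for `R` orthogonal, `t ≠ 0`, `s ≥ 0`. So if `T` is one of the given similarities, with dilation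
factor `c`, and `κ > 1`, then `W = κ c² w ∘ T⁻¹` is a supersolution with right-hand side `κ` inside
`T(K)`. It is enough to prove `u ≤ W` on `K`. Taking `κ = ι` and letting `ι ↓ 1`, the points `T_ι⁻¹
x ∈ K` tend to `x`, which yields `u(x) ≤ w^*(x)`.

Two facts remove the boundary. First, `w ≥ 0` (`supersolution_nonneg`): at a negative minimum a
constant test function is allowed, while `F` is close to `0` near `(0, 0)`. Hence `W ≥ 0`, so
wherever `u > W` also `u > 0`, and there the subsolution property holds up to the boundary of `K`.
Second, `K` lies in the interior of `T(K)`, so the doubled point on the side of `W` can be kept in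
that interior.

The comparison itself is `comparison_of_jets`: maximise the sup-convolutions of `u` and `-W` minus
`α |x - y|⁴`. Since `F` has no `x`-dependence and `κ > 1` is strict, `α` and the convolution
parameter stay fixed. `F` is singular only at `p = 0`. If the maximum has `x ≠ y`, then `p ≠ 0` and
`F_almost_monotone` contradicts `1 < κ`. If `x = y`, the quartic has vanishing gradient and Hessian,
so the Hessian on the side of `W` is almost nonnegative and `F` there is too small for a strict
supersolution.

The second-order information comes from the theorem on sums (`exists_expansions_near_max`), which
rests on `HasSubgrads.exists_expansion_near_max`. The latter gets Jensen's and Aleksandrov's results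
together, by applying Rademacher's theorem to the 1-Lipschitz inverse `S` of the subdifferential of
a strongly convex function and carrying second-order expansions back through Legendre duality. -/

noncomputable section

namespace ViscComparison

/-! ### Second-order expansions of semiconvex functions: Legendre duality, Rademacher, Jensen. -/

section Semiconvex

open scoped RealInnerProductSpace
open MeasureTheory Asymptotics

variable {H : Type*} [NormedAddCommGroup H] [InnerProductSpace ℝ H]

/-- Every point of the graph of `v` is touched from below by a paraboloid of opening `m`. For
`m = -c` this is semiconvexity with constant `c`. -/
def HasSubgrads (v : H → ℝ) (m : ℝ) : Prop :=
  ∀ z, ∃ q : H, ∀ h, v z + ⟪q, h⟫ + m / 2 * ‖h‖ ^ 2 ≤ v (z + h)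

lemma HasSubgrads.add_quadratic {v : H → ℝ} {m : ℝ} (hv : HasSubgrads v m) (c : ℝ) (a : H) :
    HasSubgrads (fun z => v z + c / 2 * ‖z - a‖ ^ 2) (m + c) := by
  intro z
  obtain ⟨q, hq⟩ := hv z
  refine ⟨q + c • (z - a), fun h => ?_⟩
  have h1 : ‖z + h - a‖ ^ 2 = ‖z - a‖ ^ 2 + 2 * ⟪z - a, h⟫ + ‖h‖ ^ 2 := by
    rw [show z + h - a = (z - a) + h by abel, norm_add_sq_real]
  have := hq h
  simp only [h1, inner_add_left, real_inner_smul_left]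
  linarith

lemma HasSubgrads.convexOn {v : H → ℝ} (hv : HasSubgrads v 0) : ConvexOn ℝ univ v := by
  refine ⟨convex_univ, fun x _ y _ a b ha hb hab => ?_⟩
  obtain ⟨q, hq⟩ := hv (a • x + b • y)
  have h1 := hq (b • (x - y))
  have h2 := hq (a • (y - x))
  have e1 : a • x + b • y + b • (x - y) = x := by
    rw [show a • x + b • y + b • (x - y) = (a + b) • x by module, hab, one_smul]
  have e2 : a • x + b • y + a • (y - x) = y := by
    rw [show a • x + b • y + a • (y - x) = (a + b) • y by module, hab, one_smul]
  rw [e1, real_inner_smul_right] at h1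
  rw [e2, real_inner_smul_right] at h2
  have e3 : ⟪q, y - x⟫ = - ⟪q, x - y⟫ := by rw [← inner_neg_right, neg_sub]
  rw [e3] at h2
  simp only [smul_eq_mul]
  have h1' := mul_le_mul_of_nonneg_left h1 ha
  have h2' := mul_le_mul_of_nonneg_left h2 hb
  have : v (a • x + b • y) = (a + b) * v (a • x + b • y) := by rw [hab, one_mul]
  rw [this]
  nlinarith

lemma HasSubgrads.continuous [FiniteDimensional ℝ H] {v : H → ℝ} {m : ℝ}
    (hv : HasSubgrads v m) : Continuous v := by
  have h0 := hv.add_quadratic (-m) 0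
  rw [add_neg_cancel] at h0
  have h1 := h0.convexOn.continuousOn isOpen_univ
  rw [continuousOn_univ] at h1
  have h2 : v = fun z => (v z + -m / 2 * ‖z - 0‖ ^ 2) + m / 2 * ‖z - 0‖ ^ 2 := by
    ext z; ring
  rw [h2]
  fun_prop

/-- A supporting hyperplane of a strongly convex function improves to a supporting paraboloid. -/
lemma HasSubgrads.strong_of_support {v : H → ℝ} {m : ℝ} (hv : HasSubgrads v m) {z q : H}
    (hz : ∀ h, v z + ⟪q, h⟫ ≤ v (z + h)) (h : H) :
    v z + ⟪q, h⟫ + m / 2 * ‖h‖ ^ 2 ≤ v (z + h) := by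
  -- Weighting the paraboloid touching at `z + t h`, evaluated at `z` and at `z + h`, by `1 - t` and
  -- `t` cancels its unknown slope and leaves the gain `t (1 - t) m/2 |h|²`. Divide by `t` and let
  -- `t ↓ 0`.
  have key : ∀ t ∈ Ioo (0 : ℝ) 1,
      v z + ⟪q, h⟫ + m / 2 * (1 - t) * ‖h‖ ^ 2 ≤ v (z + h) := by
    intro t ht
    obtain ⟨s, hs⟩ := hv (z + t • h)
    have h1 := hs (-(t • h))
    have h2 := hs ((1 - t) • h)
    have h3 := hz (t • h)
    rw [show z + t • h + -(t • h) = z by abel, norm_neg, norm_smul, inner_neg_right,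
      real_inner_smul_right, Real.norm_eq_abs, mul_pow, sq_abs] at h1
    rw [show z + t • h + (1 - t) • h = z + h by module, norm_smul,
      real_inner_smul_right, Real.norm_eq_abs, mul_pow, sq_abs] at h2
    rw [real_inner_smul_right] at h3
    have h1' := mul_le_mul_of_nonneg_left h1 (sub_nonneg.2 ht.2.le)
    have h2' := mul_le_mul_of_nonneg_left h2 ht.1.le
    have : t * (v z + ⟪q, h⟫ + m / 2 * (1 - t) * ‖h‖ ^ 2) ≤ t * v (z + h) := by linarith
    exact le_of_mul_le_mul_left this ht.1
  have hlim : Tendsto (fun t : ℝ => v z + ⟪q, h⟫ + m / 2 * (1 - t) * ‖h‖ ^ 2) (𝓝[>] 0)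
      (𝓝 (v z + ⟪q, h⟫ + m / 2 * (1 - 0) * ‖h‖ ^ 2)) := by
    apply Tendsto.mono_left _ nhdsWithin_le_nhds
    exact Continuous.tendsto (by fun_prop) 0
  rw [sub_zero, mul_one] at hlim
  exact le_of_tendsto hlim (by
    filter_upwards [Ioo_mem_nhdsGT (zero_lt_one' ℝ)] with t ht using key t ht)

/-- The subdifferential of a strongly convex function is onto: every slope is attained. -/
lemma HasSubgrads.exists_inverse [FiniteDimensional ℝ H] {v : H → ℝ} (hv : HasSubgrads v 1) :
    ∃ S : H → H, ∀ q h, v (S q) + ⟪q, h⟫ + 1 / 2 * ‖h‖ ^ 2 ≤ v (S q + h) := by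
  have : ∀ q : H, ∃ z, ∀ h, v z + ⟪q, h⟫ ≤ v (z + h) := by
    intro q
    have hc := hv.continuous
    obtain ⟨q₀, hq₀⟩ := hv 0
    -- Strong convexity makes `v - ⟪q, ·⟫` coercive, so it attains its minimum. A minimiser is a
    -- point with slope `q`.
    have hb : ∀ z, v 0 + (‖z‖ / 2 - ‖q₀ - q‖) * ‖z‖ ≤ v z - ⟪q, z⟫ := by
      intro z
      have h1 := hq₀ z
      rw [zero_add] at h1
      have h2 : -(‖q₀ - q‖ * ‖z‖) ≤ ⟪q₀ - q, z⟫ :=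
        neg_le_of_abs_le (abs_real_inner_le_norm _ _)
      rw [inner_sub_left] at h2
      nlinarith
    obtain ⟨z, hz⟩ := (show Continuous fun z => v z - ⟪q, z⟫ by fun_prop).exists_forall_le' 0 (by
      have : ∀ᶠ z in cocompact H, 2 * ‖q₀ - q‖ ≤ ‖z‖ :=
        (tendsto_norm_cocompact_atTop).eventually_ge_atTop _
      filter_upwards [this] with z hz
      have h1 := hb z
      have : 0 ≤ (‖z‖ / 2 - ‖q₀ - q‖) * ‖z‖ := mul_nonneg (by linarith) (norm_nonneg _)
      simp only [inner_zero_right]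
      linarith)
    refine ⟨z, fun h => ?_⟩
    have := hz (z + h)
    rw [inner_add_right] at this
    linarith
  choose S hS using this
  exact ⟨S, fun q h => hv.strong_of_support (hS q) h⟩

variable {v : H → ℝ} {S : H → H}

/-- Strong monotonicity of the subdifferential of a strongly convex function. -/
lemma norm_sub_le_of_strong_support {z z' q q' : H}
    (hz : ∀ h, v z + ⟪q, h⟫ + 1 / 2 * ‖h‖ ^ 2 ≤ v (z + h))
    (hz' : ∀ h, v z' + ⟪q', h⟫ + 1 / 2 * ‖h‖ ^ 2 ≤ v (z' + h)) : ‖z - z'‖ ≤ ‖q - q'‖ := by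
  have h1 := hz (z' - z)
  have h2 := hz' (z - z')
  rw [add_sub_cancel] at h1 h2
  rw [norm_sub_rev z' z, show z' - z = -(z - z') by abel, inner_neg_right] at h1
  have h3 : ‖z - z'‖ ^ 2 ≤ ⟪q - q', z - z'⟫ := by
    rw [inner_sub_left]; linarith
  have h4 := real_inner_le_norm (q - q') (z - z')
  by_contra! hlt
  have : 0 ≤ ‖q - q'‖ := norm_nonneg _
  nlinarith

lemma inverse_lipschitz (hS : ∀ q h, v (S q) + ⟪q, h⟫ + 1 / 2 * ‖h‖ ^ 2 ≤ v (S q + h)) :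
    LipschitzWith 1 S := by
  refine LipschitzWith.of_dist_le_mul fun q q' => ?_
  rw [dist_eq_norm, dist_eq_norm, NNReal.coe_one, one_mul]
  exact norm_sub_le_of_strong_support (hS q) (hS q')

lemma inverse_eq (hS : ∀ q h, v (S q) + ⟪q, h⟫ + 1 / 2 * ‖h‖ ^ 2 ≤ v (S q + h)) {z q : H}
    (hz : ∀ h, v z + ⟪q, h⟫ + 1 / 2 * ‖h‖ ^ 2 ≤ v (z + h)) : S q = z := by
  have := norm_sub_le_of_strong_support (hS q) hz
  rw [sub_self, norm_zero, norm_le_zero_iff, sub_eq_zero] at this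
  exact this

/-- The convex conjugate of `v`, expressed through the inverse `S` of its subdifferential. -/
def conj (v : H → ℝ) (S : H → H) (q : H) : ℝ := ⟪q, S q⟫ - v (S q)

lemma fenchel (hS : ∀ q h, v (S q) + ⟪q, h⟫ + 1 / 2 * ‖h‖ ^ 2 ≤ v (S q + h)) (q z : H) :
    ⟪q, z⟫ - v z ≤ conj v S q := by
  have h1 := hS q (z - S q)
  rw [add_sub_cancel, inner_sub_right] at h1
  have := sq_nonneg ‖z - S q‖
  unfold conj
  linarith

/-- Fenchel's inequality at the pairs `(q + k, S q)` and `(q, S (q + k))` traps the first-order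
remainder between `0` and `⟪k, S (q + k) - S q⟫`, which is at most `|k|²` because `S` is
1-Lipschitz. -/
lemma conj_hasFDerivAt (hS : ∀ q h, v (S q) + ⟪q, h⟫ + 1 / 2 * ‖h‖ ^ 2 ≤ v (S q + h)) (q : H) :
    HasFDerivAt (conj v S) (innerSL ℝ (S q)) q := by
  rw [hasFDerivAt_iff_isLittleO_nhds_zero]
  have hb : ∀ k, ‖conj v S (q + k) - conj v S q - innerSL ℝ (S q) k‖ ≤ 1 * ‖‖k‖ ^ 2‖ := by
    intro k
    have h1 := fenchel hS (q + k) (S q)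
    have h2 := fenchel hS q (S (q + k))
    have h3 := norm_sub_le_of_strong_support (hS (q + k)) (hS q)
    rw [add_sub_cancel_left] at h3
    have h4 := real_inner_le_norm k (S (q + k) - S q)
    have h5 : ‖k‖ * ‖S (q + k) - S q‖ ≤ ‖k‖ * ‖k‖ :=
      mul_le_mul_of_nonneg_left h3 (norm_nonneg _)
    rw [inner_add_left] at h1
    rw [inner_sub_right] at h4
    have e1 : conj v S q = ⟪q, S q⟫ - v (S q) := rfl
    have e2 : conj v S (q + k) = ⟪q, S (q + k)⟫ + ⟪k, S (q + k)⟫ - v (S (q + k)) := by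
      simp only [conj, inner_add_left]
    rw [innerSL_apply_apply, real_inner_comm, one_mul, Real.norm_eq_abs, Real.norm_eq_abs,
      abs_of_nonneg (sq_nonneg ‖k‖), abs_le]
    have := sq_nonneg ‖k‖
    constructor <;> nlinarith
  exact (IsBigO.of_bound 1 (Eventually.of_forall hb)).trans_isLittleO
    ((isLittleO_norm_pow_id (by norm_num)))

/-- Second order expansion of the conjugate at a point where its gradient is differentiable. -/
lemma conj_expansion (hS : ∀ q h, v (S q) + ⟪q, h⟫ + 1 / 2 * ‖h‖ ^ 2 ≤ v (S q + h)) {q : H}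
    {B : H →L[ℝ] H} (hB : HasFDerivAt S B q) {ε : ℝ} (hε : 0 < ε) :
    ∀ᶠ k in 𝓝 (0 : H),
      |conj v S (q + k) - conj v S q - ⟪S q, k⟫ - 1 / 2 * ⟪B k, k⟫| ≤ ε * ‖k‖ ^ 2 := by
  rw [hasFDerivAt_iff_isLittleO_nhds_zero] at hB
  obtain ⟨ρ, hρ, hball⟩ := Metric.eventually_nhds_iff_ball.1 (hB.bound hε)
  filter_upwards [Metric.ball_mem_nhds (0 : H) hρ] with k hk
  -- The gradient of the conjugate is `S`, so along the segment the remainder has derivative `⟪S (q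
  -- + t k) - S q - B (t k), k⟫`. Differentiability of `S` and the mean value inequality finish.
  have hd : ∀ t : ℝ, HasDerivAt
      (fun t : ℝ => conj v S (q + t • k) - t * ⟪S q, k⟫ - t ^ 2 * (1 / 2 * ⟪B k, k⟫))
      (⟪S (q + t • k) - S q - B (t • k), k⟫) t := by
    intro t
    have h1 : HasDerivAt (fun t : ℝ => q + t • k) k t := by
      simpa using ((hasDerivAt_id t).smul_const k).const_add q
    have h2 := (conj_hasFDerivAt hS (q + t • k)).comp_hasDerivAt t h1
    have h3 := (h2.sub ((hasDerivAt_id t).mul_const ⟪S q, k⟫)).sub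
      ((hasDerivAt_pow 2 t).mul_const (1 / 2 * ⟪B k, k⟫))
    refine h3.congr_deriv ?_
    rw [innerSL_apply_apply, inner_sub_left, inner_sub_left, map_smul, real_inner_smul_left]
    push_cast
    ring
  have hmv := norm_image_sub_le_of_norm_deriv_le_segment_01'
    (f := fun t : ℝ => conj v S (q + t • k) - t * ⟪S q, k⟫ - t ^ 2 * (1 / 2 * ⟪B k, k⟫))
    (C := ε * ‖k‖ ^ 2) (fun t _ => (hd t).hasDerivWithinAt) (by
      intro t ht
      have hle : ‖t • k‖ ≤ ‖k‖ := by
        rw [norm_smul, Real.norm_eq_abs, abs_of_nonneg ht.1]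
        exact mul_le_of_le_one_left (norm_nonneg _) ht.2.le
      have h1 := hball (t • k) (by
        rw [mem_ball_zero_iff] at hk ⊢; exact hle.trans_lt hk)
      calc ‖⟪S (q + t • k) - S q - B (t • k), k⟫‖
          ≤ ‖S (q + t • k) - S q - B (t • k)‖ * ‖k‖ := norm_inner_le_norm _ _
        _ ≤ (ε * ‖k‖) * ‖k‖ := by gcongr; exact h1.trans (by gcongr)
        _ = ε * ‖k‖ ^ 2 := by ring)
  rw [Real.norm_eq_abs] at hmv
  convert hmv using 2
  simp only [one_smul, zero_smul, add_zero]
  ring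

/-- By homogeneity a comparison near `0` can be tested at `t h` with `t ↓ 0`, where the remainder is
negligible against `t²`. This turns local inequalities between expansions into inequalities between
quadratic forms. -/
lemma le_zero_of_eventually_le_isLittleO {Q r : H → ℝ} (hQ : ∀ (t : ℝ) h, Q (t • h) = t ^ 2 * Q h)
    (hr : r =o[𝓝 0] fun h => ‖h‖ ^ 2) (hle : ∀ᶠ h in 𝓝 (0 : H), Q h ≤ r h) (h : H) :
    Q h ≤ 0 := by
  have key : ∀ ε > 0, Q h ≤ ε * ‖h‖ ^ 2 := by
    intro ε hε
    have h1 := hle.and (hr.bound hε)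
    have ht : Tendsto (fun t : ℝ => t • h) (𝓝[>] 0) (𝓝 0) := by
      have : Tendsto (fun t : ℝ => t • h) (𝓝 0) (𝓝 ((0 : ℝ) • h)) :=
        Continuous.tendsto (by fun_prop) 0
      rw [zero_smul] at this
      exact this.mono_left nhdsWithin_le_nhds
    obtain ⟨t, ⟨h2, h3⟩, ht0⟩ := ((ht.eventually h1).and self_mem_nhdsWithin).exists
    have ht0 : 0 < t := ht0
    rw [hQ] at h2
    rw [norm_pow, norm_norm, norm_smul, mul_pow, Real.norm_eq_abs, Real.norm_eq_abs, sq_abs] at h3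
    have h4 : t ^ 2 * Q h ≤ t ^ 2 * (ε * ‖h‖ ^ 2) := by
      have := le_abs_self (r (t • h)); linarith
    exact le_of_mul_le_mul_left h4 (by positivity)
  refine le_of_forall_pos_le_add fun ε hε => ?_
  have := key (ε / (‖h‖ ^ 2 + 1)) (by positivity)
  have h2 : ε / (‖h‖ ^ 2 + 1) * ‖h‖ ^ 2 ≤ ε := by
    rw [div_mul_eq_mul_div, div_le_iff₀ (by positivity)]
    nlinarith [sq_nonneg ‖h‖]
  linarith

/-- A function caught between two paraboloids at a point has only one possible slope there:
otherwise `⟪q' - q, h⟫` would be linear in the direction `q' - q` and yet `O(|h|²)`. -/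
lemma eq_of_support_of_le {z q q' : H} {m μ : ℝ}
    (hlow : ∀ h, v z + ⟪q', h⟫ + m / 2 * ‖h‖ ^ 2 ≤ v (z + h))
    (hup : ∀ᶠ h in 𝓝 (0 : H), v (z + h) ≤ v z + ⟪q, h⟫ + μ / 2 * ‖h‖ ^ 2) : q' = q := by
  have h1 : ∀ᶠ e in 𝓝 (0 : H), ⟪q' - q, e⟫ ≤ (|μ| + |m| + 1) * ‖e‖ ^ 2 := by
    filter_upwards [hup] with e he'
    have := hlow e
    rw [inner_sub_left]
    have h1 : (μ / 2 - m / 2) * ‖e‖ ^ 2 ≤ (|μ| + |m| + 1) * ‖e‖ ^ 2 := by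
      gcongr
      linarith [le_abs_self μ, neg_abs_le m, abs_nonneg μ, abs_nonneg m]
    linarith
  by_contra hne
  have hkpos : 0 < ‖q' - q‖ := norm_pos_iff.2 (sub_ne_zero.2 hne)
  have hC : 0 < |μ| + |m| + 1 := by positivity
  have ht : Tendsto (fun t : ℝ => t • (q' - q)) (𝓝[>] 0) (𝓝 0) := by
    have : Tendsto (fun t : ℝ => t • (q' - q)) (𝓝 0) (𝓝 ((0 : ℝ) • (q' - q))) :=
      Continuous.tendsto (by fun_prop) 0
    rw [zero_smul] at this
    exact this.mono_left nhdsWithin_le_nhds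
  obtain ⟨t, h2, ht0⟩ := ((ht.eventually h1).and
    (Ioo_mem_nhdsGT (show (0 : ℝ) < 1 / (|μ| + |m| + 1) by positivity))).exists
  rw [real_inner_smul_right, norm_smul, mul_pow, Real.norm_eq_abs, sq_abs,
    real_inner_self_eq_norm_sq] at h2
  have h3 : 0 < t * ‖q' - q‖ ^ 2 := mul_pos ht0.1 (by positivity)
  have h4 : (|μ| + |m| + 1) * t < 1 := by
    have := ht0.2
    rw [lt_div_iff₀ hC] at this
    linarith
  nlinarith

/-- If `v` is strongly convex, touched from above at `S q` by a paraboloid, and the inverse `S` of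
its subdifferential is differentiable at `q`, then `v` has a second order expansion at `S q`. -/
lemma HasSubgrads.exists_expansion [FiniteDimensional ℝ H] (hv : HasSubgrads v 1)
    (hS : ∀ q h, v (S q) + ⟪q, h⟫ + 1 / 2 * ‖h‖ ^ 2 ≤ v (S q + h)) {q : H}
    (hd : DifferentiableAt ℝ S q) {μ : ℝ} (hμ : 0 < μ)
    (hup : ∀ᶠ h in 𝓝 (0 : H), v (S q + h) ≤ v (S q) + ⟪q, h⟫ + μ / 2 * ‖h‖ ^ 2) :
    ∃ X : H →L[ℝ] H, (∀ a b, ⟪X a, b⟫ = ⟪a, X b⟫) ∧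
      (fun h => v (S q + h) - v (S q) - ⟪q, h⟫ - 1 / 2 * ⟪X h, h⟫) =o[𝓝 0] fun h => ‖h‖ ^ 2 := by
  obtain ⟨B, hB⟩ := hd
  have hconj : conj v S q = ⟪q, S q⟫ - v (S q) := rfl
  -- coercivity of the derivative of `S`
  have hcoer : ∀ k, 1 / μ * ‖k‖ ^ 2 ≤ ⟪B k, k⟫ := by
    intro k
    -- Conjugation reverses order: a paraboloid of opening `μ` above `v` becomes one of opening
    -- `1/μ` below the conjugate. The point `S q + k/μ` is the maximiser in the conjugate of the
    -- paraboloid.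
    have hlow : ∀ᶠ k in 𝓝 (0 : H),
        conj v S q + ⟪S q, k⟫ + 1 / (2 * μ) * ‖k‖ ^ 2 ≤ conj v S (q + k) := by
      have ht : Tendsto (fun k : H => (1 / μ) • k) (𝓝 0) (𝓝 0) := by
        have : Tendsto (fun k : H => (1 / μ) • k) (𝓝 0) (𝓝 ((1 / μ) • (0 : H))) :=
          Continuous.tendsto (by fun_prop) 0
        rwa [smul_zero] at this
      filter_upwards [ht.eventually hup] with k hk
      have h1 := fenchel hS (q + k) (S q + (1 / μ) • k)
      rw [norm_smul, real_inner_smul_right, mul_pow, Real.norm_eq_abs, sq_abs] at hk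
      simp only [inner_add_left, inner_add_right, real_inner_smul_right,
        real_inner_self_eq_norm_sq] at h1
      have e : μ / 2 * ((1 / μ) ^ 2 * ‖k‖ ^ 2) = 1 / (2 * μ) * ‖k‖ ^ 2 := by field_simp
      have e2 : 1 / μ * ‖k‖ ^ 2 = 2 * (1 / (2 * μ) * ‖k‖ ^ 2) := by field_simp
      rw [real_inner_comm k (S q)]
      linarith
    have := le_zero_of_eventually_le_isLittleO (Q := fun k => 1 / μ * ‖k‖ ^ 2 - ⟪B k, k⟫)
      (r := fun k => 2 * (conj v S (q + k) - conj v S q - ⟪S q, k⟫ - 1 / 2 * ⟪B k, k⟫))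
      (by
        intro t h
        rw [norm_smul, map_smul, real_inner_smul_left, real_inner_smul_right, mul_pow,
          Real.norm_eq_abs, sq_abs]
        ring)
      (by
        refine IsLittleO.const_mul_left ?_ 2
        rw [isLittleO_iff]
        intro c hc
        filter_upwards [conj_expansion hS hB hc] with k hk
        rwa [norm_pow, norm_norm, Real.norm_eq_abs])
      (by
        filter_upwards [hlow] with k hk
        have e2 : 1 / μ * ‖k‖ ^ 2 = 2 * (1 / (2 * μ) * ‖k‖ ^ 2) := by field_simp
        linarith) k
    linarith
  -- symmetrise and invert
  set A : H →L[ℝ] H := (1 / 2 : ℝ) • (B + ContinuousLinearMap.adjoint B) with hA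
  have hAq : ∀ k, ⟪A k, k⟫ = ⟪B k, k⟫ := by
    intro k
    simp only [hA, smul_apply, add_apply,
      real_inner_smul_left, inner_add_left, ContinuousLinearMap.adjoint_inner_left]
    rw [real_inner_comm (B k) k]
    ring
  have hAsymm : ∀ a b, ⟪A a, b⟫ = ⟪a, A b⟫ := by
    intro a b
    simp only [hA, smul_apply, add_apply,
      real_inner_smul_left, real_inner_smul_right, inner_add_left, inner_add_right,
      ContinuousLinearMap.adjoint_inner_left, ContinuousLinearMap.adjoint_inner_right]
    ring
  have hApos : ∀ k, 0 ≤ ⟪A k, k⟫ := fun k => by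
    rw [hAq]; exact le_trans (by positivity) (hcoer k)
  have hinj : Function.Injective (A : H →ₗ[ℝ] H) := by
    rw [injective_iff_map_eq_zero]
    intro k hk
    have h1 := hcoer k
    have hk' : A k = 0 := hk
    rw [← hAq, hk', inner_zero_left] at h1
    have h2 : ‖k‖ ^ 2 ≤ 0 := by
      by_contra! hlt
      have : 0 < 1 / μ * ‖k‖ ^ 2 := by positivity
      linarith
    have h3 : ‖k‖ = 0 := by nlinarith [sq_nonneg ‖k‖]
    exact norm_eq_zero.1 h3
  set e := LinearEquiv.ofInjectiveEndo (A : H →ₗ[ℝ] H) hinj with he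
  set X : H →L[ℝ] H := LinearMap.toContinuousLinearMap (e.symm : H →ₗ[ℝ] H) with hX
  have hAX : ∀ h, A (X h) = h := fun h => e.apply_symm_apply h
  refine ⟨X, fun a b => ?_, ?_⟩
  · have h1 := hAsymm (X a) (X b)
    rw [hAX, hAX] at h1
    exact h1.symm
  -- the expansion
  obtain ⟨r, hr, hupr⟩ := Metric.eventually_nhds_iff_ball.1 hup
  set C : ℝ := ‖X‖ ^ 2 + (2 * μ) ^ 2 with hC
  have hCpos : 0 < C := by positivity
  rw [isLittleO_iff]
  intro c hc
  obtain ⟨ρ, hρ, hexp⟩ := Metric.eventually_nhds_iff_ball.1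
    (conj_expansion hS hB (show 0 < c / C by positivity))
  have hsmall : ∀ᶠ h in 𝓝 (0 : H), ‖h‖ * (‖X‖ + 2 * μ) < ρ := by
    have : Tendsto (fun h : H => ‖h‖ * (‖X‖ + 2 * μ)) (𝓝 0) (𝓝 (‖(0 : H)‖ * (‖X‖ + 2 * μ))) :=
      Continuous.tendsto (by fun_prop) 0
    rw [norm_zero, zero_mul] at this
    exact this.eventually_lt_const hρ
  filter_upwards [hsmall, Metric.ball_mem_nhds (0 : H) (half_pos hr)] with h hh hhr
  rw [mem_ball_zero_iff] at hhr
  rw [norm_pow, norm_norm, Real.norm_eq_abs, abs_le]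
  have hnn := norm_nonneg h
  have hXn : ‖X h‖ ≤ ‖X‖ * ‖h‖ := X.le_opNorm h
  constructor
  -- Lower bound: Fenchel's inequality at `S q + h` with slope `q + X h`, the slope predicted by the
  -- expansion.
  · have hk : X h ∈ Metric.ball (0 : H) ρ := by
      rw [mem_ball_zero_iff]
      nlinarith
    have h1 := (abs_le.1 (hexp _ hk)).2
    have h2 := fenchel hS (q + X h) (S q + h)
    rw [← hAq, hAX] at h1
    have h3 : c / C * ‖X h‖ ^ 2 ≤ c * ‖h‖ ^ 2 := by
      have : ‖X h‖ ^ 2 ≤ C * ‖h‖ ^ 2 := by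
        calc ‖X h‖ ^ 2 ≤ (‖X‖ * ‖h‖) ^ 2 := by gcongr
          _ ≤ C * ‖h‖ ^ 2 := by rw [mul_pow]; gcongr; rw [hC]; nlinarith [sq_nonneg μ]
      calc c / C * ‖X h‖ ^ 2 ≤ c / C * (C * ‖h‖ ^ 2) := by gcongr
        _ = c * ‖h‖ ^ 2 := by field_simp
    simp only [inner_add_left, inner_add_right] at h2
    rw [real_inner_comm (X h) (S q), real_inner_comm (X h) h] at h1
    linarith
  -- Upper bound: Fenchel is an equality for the actual slope `q'` at `S q + h`, and positivity of
  -- `A` at `q' - q - X h` replaces `q' - q` by `X h`. This needs `|q' - q| = O(|h|)`, obtained by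
  -- moving a distance `|h|` from `S q + h` in the direction `q' - q` and using the upper
  -- paraboloid.
  · obtain ⟨q', hq'⟩ := hv (S q + h)
    have hSq' : S q' = S q + h := inverse_eq hS hq'
    have hk : ‖q' - q‖ ≤ 2 * μ * ‖h‖ := by
      rcases eq_or_ne (q' - q) 0 with h0 | h0
      · rw [h0, norm_zero]; positivity
      have hkpos : 0 < ‖q' - q‖ := norm_pos_iff.2 h0
      rcases eq_or_lt_of_le hnn with hh0 | hh0
      · have hh0' : h = 0 := norm_eq_zero.1 hh0.symm
        rw [hh0', add_zero] at hq'
        rw [eq_of_support_of_le hq' hup, sub_self, norm_zero]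
        positivity
      · set a : H := (‖h‖ / ‖q' - q‖) • (q' - q) with ha
        have hna : ‖a‖ = ‖h‖ := by
          rw [ha, norm_smul, Real.norm_eq_abs, abs_of_nonneg (by positivity)]
          field_simp
        have hqa : ⟪q' - q, a⟫ = ‖h‖ * ‖q' - q‖ := by
          rw [ha, real_inner_smul_right, real_inner_self_eq_norm_sq]
          field_simp
        have hha : ‖h + a‖ ≤ 2 * ‖h‖ := by
          have := norm_add_le h a
          linarith
        have h1 := hq' a
        have h2 := hupr (h + a) (by rw [mem_ball_zero_iff]; linarith)
        have h3 := hS q h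
        rw [← add_assoc] at h2
        rw [inner_add_right] at h2
        rw [inner_sub_left] at hqa
        have h4 : μ / 2 * ‖h + a‖ ^ 2 ≤ μ / 2 * (2 * ‖h‖) ^ 2 := by gcongr
        have h5 : ‖h‖ * ‖q' - q‖ ≤ ‖h‖ * (2 * μ * ‖h‖) := by
          nlinarith [sq_nonneg ‖h‖, sq_nonneg ‖a‖]
        exact le_of_mul_le_mul_left h5 hh0
    have hkb : q' - q ∈ Metric.ball (0 : H) ρ := by
      rw [mem_ball_zero_iff]
      nlinarith [norm_nonneg X]
    have h1 := (abs_le.1 (hexp _ hkb)).1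
    rw [add_sub_cancel, ← hAq] at h1
    have h2 : conj v S q' = ⟪q', S q + h⟫ - v (S q + h) := by rw [conj, hSq']
    have h3 := hApos (q' - q - X h)
    rw [map_sub, hAX, inner_sub_left, inner_sub_right _ (q' - q), inner_sub_right h,
      hAsymm (q' - q) (X h), hAX, real_inner_comm (X h) h, real_inner_comm (q' - q) h] at h3
    have h4 : c / C * ‖q' - q‖ ^ 2 ≤ c * ‖h‖ ^ 2 := by
      have : ‖q' - q‖ ^ 2 ≤ C * ‖h‖ ^ 2 := by
        calc ‖q' - q‖ ^ 2 ≤ (2 * μ * ‖h‖) ^ 2 := by gcongr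
          _ ≤ C * ‖h‖ ^ 2 := by rw [mul_pow]; gcongr; rw [hC]; nlinarith [sq_nonneg ‖X‖]
      calc c / C * ‖q' - q‖ ^ 2 ≤ c / C * (C * ‖h‖ ^ 2) := by gcongr
        _ = c * ‖h‖ ^ 2 := by field_simp
    have e1 : ⟪q' - q, h⟫ = ⟪q', h⟫ - ⟪q, h⟫ := inner_sub_left _ _ _
    have e2 : ⟪S q, q' - q⟫ = ⟪q', S q⟫ - ⟪q, S q⟫ := by
      rw [real_inner_comm, inner_sub_left]
    rw [inner_add_right] at h2
    linarith


/-- **Jensen's lemma combined with Aleksandrov's theorem.** Arbitrarily close to a local maximum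
of a semiconvex function there is a point with a second order expansion whose gradient is small
and whose Hessian is almost nonpositive. -/
theorem HasSubgrads.exists_expansion_near_max [FiniteDimensional ℝ H] {g : H → ℝ} {c : ℝ}
    (hc : 0 ≤ c) (hg : HasSubgrads g (-c)) {z₀ : H} (hmax : IsLocalMax g z₀) {δ : ℝ} (hδ : 0 < δ) :
    ∃ (z p : H) (X : H →L[ℝ] H), ‖z - z₀‖ < δ ∧ ‖p‖ < δ ∧ (∀ a b, ⟪X a, b⟫ = ⟪a, X b⟫) ∧
      (∀ h, ⟪X h, h⟫ ≤ δ * ‖h‖ ^ 2) ∧ (∀ h, -c * ‖h‖ ^ 2 ≤ ⟪X h, h⟫) ∧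
      (fun h => g (z + h) - g z - ⟪p, h⟫ - 1 / 2 * ⟪X h, h⟫) =o[𝓝 0] fun h => ‖h‖ ^ 2 := by
  let _ : MeasurableSpace H := borel H
  have : BorelSpace H := ⟨rfl⟩
  have hgc := hg.continuous
  set v : H → ℝ := fun z => g z + (c + 1) / 2 * ‖z - z₀‖ ^ 2 with hvdef
  have hv : HasSubgrads v 1 := by
    have := hg.add_quadratic (c + 1) z₀
    rwa [show -c + (c + 1) = 1 by ring] at this
  obtain ⟨S, hS⟩ := hv.exists_inverse
  set μ : ℝ := c + 1 + δ with hμ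
  have hμpos : 0 < μ := by positivity
  obtain ⟨r₀, hr₀, hloc⟩ := Metric.eventually_nhds_iff_ball.1 hmax
  -- The second bound gives `r < δ` and keeps the final gradient `p + δ (z - z₀)` below `δ`.
  obtain ⟨r, hr, hrr, hr1⟩ : ∃ r > 0, r < r₀ ∧ 2 * r * (1 + δ) < δ := by
    refine ⟨min (r₀ / 2) (δ / (4 * (1 + δ))), by positivity, ?_, ?_⟩
    · exact (min_le_left _ _).trans_lt (half_lt_self hr₀)
    · calc 2 * min (r₀ / 2) (δ / (4 * (1 + δ))) * (1 + δ) ≤ 2 * (δ / (4 * (1 + δ))) * (1 + δ) := by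
            gcongr; exact min_le_right _ _
        _ = δ / 2 := by field_simp; ring
        _ < δ := half_lt_self hδ
  -- perturbed maxima
  have hpert : ∀ p ∈ Metric.ball (0 : H) (δ / 2 * r), ∃ z, ‖z - z₀‖ < r ∧
      ∀ᶠ h in 𝓝 (0 : H), v (z + h) ≤ v z + ⟪p + μ • (z - z₀), h⟫ + μ / 2 * ‖h‖ ^ 2 := by
    intro p hp
    rw [mem_ball_zero_iff] at hp
    obtain ⟨z, hz, hzmax⟩ := (isCompact_closedBall z₀ r).exists_isMaxOn
      ⟨z₀, Metric.mem_closedBall_self hr.le⟩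
      (show ContinuousOn (fun z => g z - δ / 2 * ‖z - z₀‖ ^ 2 - ⟪p, z - z₀⟫)
        (Metric.closedBall z₀ r) by fun_prop)
    have hz' : ‖z - z₀‖ ≤ r := by rwa [mem_closedBall_iff_norm] at hz
    -- On the sphere of radius `r` the penalty `δ/2 r²` beats the linear term, since `|p| < δ/2 r`.
    -- The maximum is therefore interior.
    have hzr : ‖z - z₀‖ < r := by
      have h1 := hzmax (Metric.mem_closedBall_self hr.le)
      simp only [mem_ofPred_eq, sub_self, norm_zero, inner_zero_right] at h1
      have h2 := hloc z (by rw [mem_ball_iff_norm]; linarith)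
      have h3 := neg_le_of_abs_le (abs_real_inner_le_norm p (z - z₀))
      by_contra! hge
      have h4 : ‖z - z₀‖ = r := le_antisymm hz' hge
      rw [h4] at h1 h3
      nlinarith
    refine ⟨z, hzr, ?_⟩
    have hball : ∀ᶠ h in 𝓝 (0 : H), ‖h‖ < r - ‖z - z₀‖ := by
      have := Metric.ball_mem_nhds (0 : H) (sub_pos.2 hzr)
      filter_upwards [this] with h hh
      rwa [mem_ball_zero_iff] at hh
    filter_upwards [hball] with h hh
    have h1 := hzmax (show z + h ∈ Metric.closedBall z₀ r by
      rw [mem_closedBall_iff_norm, show z + h - z₀ = (z - z₀) + h by abel]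
      exact (norm_add_le _ _).trans (by linarith))
    simp only [mem_ofPred_eq] at h1
    have e : ‖z + h - z₀‖ ^ 2 = ‖z - z₀‖ ^ 2 + 2 * ⟪z - z₀, h⟫ + ‖h‖ ^ 2 := by
      rw [show z + h - z₀ = (z - z₀) + h by abel, norm_add_sq_real]
    have e2 : ⟪p, z + h - z₀⟫ = ⟪p, z - z₀⟫ + ⟪p, h⟫ := by
      rw [show z + h - z₀ = (z - z₀) + h by abel, inner_add_right]
    rw [e2, e] at h1
    simp only [hvdef, e, inner_add_left, real_inner_smul_left, hμ]
    linarith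
  choose! Z hZr hZup using hpert
  set A : Set H := (fun p => p + μ • (Z p - z₀)) '' Metric.ball (0 : H) (δ / 2 * r) with hA
  have hSZ : ∀ p ∈ Metric.ball (0 : H) (δ / 2 * r), S (p + μ • (Z p - z₀)) = Z p := by
    intro p hp
    obtain ⟨q', hq'⟩ := hv (Z p)
    have := eq_of_support_of_le hq' (hZup p hp)
    rw [this] at hq'
    exact inverse_eq hS hq'
  have hSlip := inverse_lipschitz hS
  -- a contact slope at which `S` is differentiable
  obtain ⟨p, hp, hdiff⟩ : ∃ p ∈ Metric.ball (0 : H) (δ / 2 * r),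
      DifferentiableAt ℝ S (p + μ • (Z p - z₀)) := by
    by_contra! hcon
    set d : ℝ := (Module.finrank ℝ H : ℝ) with hd
    have hnull : (μH[d] : Measure H) {q | ¬ DifferentiableAt ℝ S q} = 0 :=
      hSlip.ae_differentiableAt (μ := (μH[d] : Measure H))
    have hAnull : (μH[d] : Measure H) A = 0 := by
      refine measure_mono_null ?_ hnull
      rintro _ ⟨p, hp, rfl⟩
      exact hcon p hp
    -- The perturbation is a Lipschitz function of the contact slope: `p = q - μ (S q - z₀)`. A null
    -- set of contact slopes would therefore have a null image, but the image contains a ball.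
    obtain ⟨C, hC⟩ : ∃ C, LipschitzWith C (fun q => q - μ • (S q - z₀)) :=
      ⟨_, LipschitzWith.id.sub
        ((lipschitzWith_smul μ).comp (hSlip.sub (LipschitzWith.const z₀)))⟩
    have h1 := hC.hausdorffMeasure_image_le (d := d) (by positivity) A
    rw [hAnull, mul_zero] at h1
    have h2 : Metric.ball (0 : H) (δ / 2 * r) ⊆ (fun q => q - μ • (S q - z₀)) '' A := by
      intro p hp
      refine ⟨_, ⟨p, hp, rfl⟩, ?_⟩
      simp only [hSZ p hp, add_sub_cancel_right]
    have h3 : (μH[d] : Measure H) (Metric.ball (0 : H) (δ / 2 * r)) = 0 :=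
      measure_mono_null h2 (le_antisymm h1 bot_le)
    exact (Metric.measure_ball_pos (μH[d] : Measure H) 0 (by positivity)).ne' h3
  have hup := hZup p hp
  have hS' := hS (p + μ • (Z p - z₀))
  rw [hSZ p hp] at hS'
  obtain ⟨X, hXs, hXe⟩ := hv.exists_expansion hS hdiff hμpos (by rwa [hSZ p hp])
  rw [hSZ p hp] at hXe
  have hzr := hZr p hp
  rw [mem_ball_zero_iff] at hp
  have hup' : ∀ h, ⟪X h, h⟫ ≤ μ * ‖h‖ ^ 2 := by
    intro h
    have := le_zero_of_eventually_le_isLittleO (Q := fun h => ⟪X h, h⟫ - μ * ‖h‖ ^ 2)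
      (by
        intro t h
        rw [norm_smul, map_smul, real_inner_smul_left, real_inner_smul_right, mul_pow,
          Real.norm_eq_abs, sq_abs]
        ring) (hXe.const_mul_left (-2)) (by
        filter_upwards [hup] with h hh
        linarith) h
    linarith
  have hlow' : ∀ h, ‖h‖ ^ 2 ≤ ⟪X h, h⟫ := by
    intro h
    have := le_zero_of_eventually_le_isLittleO (Q := fun h => ‖h‖ ^ 2 - ⟪X h, h⟫)
      (by
        intro t h
        rw [norm_smul, map_smul, real_inner_smul_left, real_inner_smul_right, mul_pow,
          Real.norm_eq_abs, sq_abs]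
        ring) (hXe.const_mul_left 2) (by
        filter_upwards with h
        have := hS' h
        linarith) h
    linarith
  -- Removing the added `(c + 1)/2 |z - z₀|²` leaves the slope `p + (μ - c - 1)(z - z₀)` with `μ - c
  -- - 1 = δ`, and turns `1 ≤ X ≤ μ` into the bounds `-c` and `δ`.
  refine ⟨Z p, p + δ • (Z p - z₀), X - (c + 1) • ContinuousLinearMap.id ℝ H, ?_, ?_, ?_, ?_, ?_, ?_⟩
  · nlinarith
  · calc ‖p + δ • (Z p - z₀)‖ ≤ ‖p‖ + ‖δ • (Z p - z₀)‖ := norm_add_le _ _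
      _ = ‖p‖ + δ * ‖Z p - z₀‖ := by rw [norm_smul, Real.norm_eq_abs, abs_of_pos hδ]
      _ < δ / 2 * r + δ * r := by gcongr
      _ ≤ δ := by nlinarith
  · intro a b
    simp [inner_sub_left, inner_sub_right, hXs, real_inner_smul_left, real_inner_smul_right]
  · intro h
    have := hup' h
    simp only [sub_apply, smul_apply,
      ContinuousLinearMap.id_apply, inner_sub_left, real_inner_smul_left,
      real_inner_self_eq_norm_sq]
    rw [hμ] at this
    linarith
  · intro h
    have := hlow' h
    simp only [sub_apply, smul_apply,
      ContinuousLinearMap.id_apply, inner_sub_left, real_inner_smul_left,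
      real_inner_self_eq_norm_sq]
    linarith
  · refine hXe.congr_left fun h => ?_
    have e : ‖Z p + h - z₀‖ ^ 2 = ‖Z p - z₀‖ ^ 2 + 2 * ⟪Z p - z₀, h⟫ + ‖h‖ ^ 2 := by
      rw [show Z p + h - z₀ = (Z p - z₀) + h by abel, norm_add_sq_real]
    simp only [hvdef, e, sub_apply, smul_apply,
      ContinuousLinearMap.id_apply, inner_sub_left, inner_add_left, real_inner_smul_left,
      real_inner_self_eq_norm_sq, hμ]
    ring

end Semiconvex

/-! ### The operator `F`: bounds, invariance, and almost monotonicity away from `p = 0`. -/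

section Operator

open Matrix

variable {n k : ℕ} {L : ℝ}

/-- The ordered eigenvalues are the sorted roots of the characteristic polynomial, which conjugation
preserves. -/
lemma ordEig_conj {O a : Matrix (Fin n) (Fin n) ℝ} (hO : Oᵀ * O = 1) (ha : a.IsHermitian)
    (i : ℕ) : ordEig i (O * a * Oᵀ) = ordEig i a := by
  have hb : (O * a * Oᵀ).IsHermitian := by
    have := isHermitian_mul_mul_conjTranspose O ha
    rwa [conjTranspose_eq_transpose_of_trivial] at this
  have hchar : (O * a * Oᵀ).charpoly = a.charpoly := by
    rw [mul_assoc, charpoly_mul_comm, mul_assoc, hO, mul_one]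
  unfold ordEig
  by_cases hi : 1 ≤ i ∧ i ≤ n
  · rw [dif_pos ⟨hb, hi⟩, dif_pos ⟨ha, hi⟩]
    have : hb.eigenvalues₀ = ha.eigenvalues₀ := by
      simp_rw [← List.ofFn_inj, ← IsHermitian.sort_roots_charpoly_eq_eigenvalues₀, hchar]
    rw [this]
  · rw [dif_neg (fun h => hi h.2), dif_neg (fun h => hi h.2)]

lemma admissible_conj {O a : Matrix (Fin n) (Fin n) ℝ} (hO : Oᵀ * O = 1) {p q : E n} {t : ℝ}
    (hq : Oᵀ *ᵥ q.ofLp = t • p.ofLp) (ha : a ∈ admissible n k L p) :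
    O * a * Oᵀ ∈ admissible n k L q := by
  obtain ⟨h1, h2, h3, h4⟩ := ha
  refine ⟨?_, ?_, ?_, ?_⟩
  · have := h1.mul_mul_conjTranspose_same O
    rwa [conjTranspose_eq_transpose_of_trivial] at this
  · rw [← mulVec_mulVec, hq, mulVec_smul, ← mulVec_mulVec, h2, mulVec_zero, smul_zero]
  · rwa [ordEig_conj hO h1.isHermitian]
  · rwa [ordEig_conj hO h1.isHermitian]

lemma admissible_conj_symm {O b : Matrix (Fin n) (Fin n) ℝ} (hO : Oᵀ * O = 1) {p q : E n} {t : ℝ}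
    (ht : t ≠ 0) (hq : Oᵀ *ᵥ q.ofLp = t • p.ofLp) (hb : b ∈ admissible n k L q) :
    Oᵀ * b * O ∈ admissible n k L p := by
  have hO' : O * Oᵀ = 1 := mul_eq_one_comm.1 hO
  have hp : Oᵀᵀ *ᵥ p.ofLp = t⁻¹ • q.ofLp := by
    have h1 : p.ofLp = t⁻¹ • (Oᵀ *ᵥ q.ofLp) := by rw [hq, smul_smul, inv_mul_cancel₀ ht, one_smul]
    rw [h1, transpose_transpose, mulVec_smul, mulVec_mulVec, hO', one_mulVec]
  have hmem := admissible_conj (O := Oᵀ) (by rwa [transpose_transpose]) hp hb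
  rwa [transpose_transpose] at hmem

lemma trace_le_of_mem_admissible (hn : 1 ≤ n) {p : E n} {a : Matrix (Fin n) (Fin n) ℝ}
    (ha : a ∈ admissible n k L p) : a.trace ≤ n * L := by
  obtain ⟨h1, -, -, h4⟩ := ha
  rw [h1.isHermitian.trace_eq_sum_eigenvalues]
  have hle : ∀ i, h1.isHermitian.eigenvalues i ≤ L := by
    intro i
    refine le_trans ?_ h4
    unfold ordEig
    rw [dif_pos ⟨h1.isHermitian, le_rfl, hn⟩]
    exact h1.isHermitian.eigenvalues₀_antitone (Fin.le_def.2 (Nat.zero_le _))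
  calc ∑ i, ((h1.isHermitian.eigenvalues i : ℝ) : ℝ) ≤ ∑ _i : Fin n, L :=
        Finset.sum_le_sum fun i _ => hle i
    _ = n * L := by simp

/-- Testing positivity on `e_i ± e_j` gives `2 |a_ij| ≤ a_ii + a_jj`. -/
lemma abs_entry_le_trace {a : Matrix (Fin n) (Fin n) ℝ} (ha : a.PosSemidef) (i j : Fin n) :
    |a i j| ≤ a.trace := by
  have hd : ∀ l, a l l ≤ a.trace := fun l =>
    Finset.single_le_sum (f := fun l => a l l) (fun l _ => ha.diag_nonneg) (Finset.mem_univ l)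
  have hs : a j i = a i j := by
    have := ha.isHermitian.apply i j
    simpa using this
  have h1 := ha.dotProduct_mulVec_nonneg (Pi.single i 1 + Pi.single j 1)
  have h2 := ha.dotProduct_mulVec_nonneg (Pi.single i 1 - Pi.single j 1)
  simp only [star_trivial, mulVec_add, mulVec_sub, mulVec_single_one, add_dotProduct,
    sub_dotProduct, dotProduct_add, dotProduct_sub, single_dotProduct, one_mul, col_apply] at h1 h2
  have hi := hd i
  have hj := hd j
  rw [abs_le]
  constructor <;> linarith

lemma abs_trace_mul_le (M : Matrix (Fin n) (Fin n) ℝ) {a : Matrix (Fin n) (Fin n) ℝ} {A : ℝ}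
    (ha : ∀ i j, |a i j| ≤ A) : |(M * a).trace| ≤ (∑ i, ∑ j, |M i j|) * A := by
  simp only [trace, diag_apply, mul_apply]
  refine (Finset.abs_sum_le_sum_abs _ _).trans ?_
  rw [Finset.sum_mul]
  refine Finset.sum_le_sum fun i _ => (Finset.abs_sum_le_sum_abs _ _).trans ?_
  rw [Finset.sum_mul]
  refine Finset.sum_le_sum fun j _ => ?_
  rw [abs_mul]
  exact mul_le_mul_of_nonneg_left (ha j i) (abs_nonneg _)

lemma abs_entry_le_of_mem_admissible (hn : 1 ≤ n) {p : E n} {a : Matrix (Fin n) (Fin n) ℝ}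
    (ha : a ∈ admissible n k L p) (i j : Fin n) : |a i j| ≤ n * L :=
  (abs_entry_le_trace ha.1 i j).trans (trace_le_of_mem_admissible hn ha)

lemma bddBelow_image_admissible (hn : 1 ≤ n) (p : E n) (M : Matrix (Fin n) (Fin n) ℝ) :
    BddBelow ((fun a => -(1 / 2 : ℝ) * (M * a).trace) '' admissible n k L p) := by
  refine ⟨-(1 / 2) * ((∑ i, ∑ j, |M i j|) * (n * L)), ?_⟩
  rintro _ ⟨a, ha, rfl⟩
  have := (abs_le.1 (abs_trace_mul_le M (abs_entry_le_of_mem_admissible hn ha))).2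
  simp only
  linarith

lemma F_le (hn : 1 ≤ n) {p : E n} (M : Matrix (Fin n) (Fin n) ℝ) {a : Matrix (Fin n) (Fin n) ℝ}
    (ha : a ∈ admissible n k L p) : F n k L (p, M) ≤ -(1 / 2 : ℝ) * (M * a).trace :=
  csInf_le (bddBelow_image_admissible hn p M) ⟨a, ha, rfl⟩

lemma abs_F_le (hn : 1 ≤ n) (hL : 0 ≤ L) (p : E n) (M : Matrix (Fin n) (Fin n) ℝ) :
    |F n k L (p, M)| ≤ (∑ i, ∑ j, |M i j|) * (n * L) := by
  have hS : 0 ≤ (∑ i, ∑ j, |M i j|) * (n * L) := by positivity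
  rcases (admissible n k L p).eq_empty_or_nonempty with h | ⟨a, ha⟩
  · simpa [F, h] using hS
  · have hb : ∀ a ∈ admissible n k L p, |(M * a).trace| ≤ (∑ i, ∑ j, |M i j|) * (n * L) :=
      fun a ha => abs_trace_mul_le M (abs_entry_le_of_mem_admissible hn ha)
    rw [abs_le]
    constructor
    · refine le_csInf ⟨_, a, ha, rfl⟩ ?_
      rintro _ ⟨b, hb', rfl⟩
      have := (abs_le.1 (hb b hb')).2
      simp only
      linarith
    · refine (F_le hn M ha).trans ?_
      have := (abs_le.1 (hb a ha)).1
      linarith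

/-- Scaling and rotation invariance of `F`. -/
lemma F_conj {O : Matrix (Fin n) (Fin n) ℝ} (hO : Oᵀ * O = 1) {p q : E n} {s t : ℝ} (hs : 0 ≤ s)
    (ht : t ≠ 0) (hq : Oᵀ *ᵥ q.ofLp = t • p.ofLp) (M : Matrix (Fin n) (Fin n) ℝ) :
    F n k L (q, s • (O * M * Oᵀ)) = s * F n k L (p, M) := by
  have hO' : O * Oᵀ = 1 := mul_eq_one_comm.1 hO
  have htr : ∀ a, (s • (O * M * Oᵀ) * (O * a * Oᵀ)).trace = s * (M * a).trace := by
    intro a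
    rw [smul_mul_assoc, trace_smul, smul_eq_mul,
      show O * M * Oᵀ * (O * a * Oᵀ) = O * (M * (Oᵀ * O) * a * Oᵀ) by simp only [mul_assoc],
      trace_mul_comm, mul_assoc, hO, mul_one, mul_one]
  unfold F
  rw [← smul_eq_mul (a := s) (b := sInf _), ← Real.sInf_smul_of_nonneg hs]
  congr 1
  ext y
  simp only [mem_image, Set.mem_smul_set]
  constructor
  · rintro ⟨b, hb, rfl⟩
    have hmem := admissible_conj_symm hO ht hq hb
    refine ⟨_, ⟨_, hmem, rfl⟩, ?_⟩
    have := htr (Oᵀ * b * O)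
    rw [show O * (Oᵀ * b * O) * Oᵀ = (O * Oᵀ) * b * (O * Oᵀ) by simp only [mul_assoc], hO',
      one_mul, mul_one] at this
    rw [this, smul_eq_mul]
    ring
  · rintro ⟨_, ⟨a, ha, rfl⟩, rfl⟩
    refine ⟨_, admissible_conj hO hq ha, ?_⟩
    rw [htr, smul_eq_mul]
    ring

lemma trace_mul_nonneg_of_posSemidef {M a : Matrix (Fin n) (Fin n) ℝ} (hM : M.PosSemidef)
    (ha : a.PosSemidef) : 0 ≤ (M * a).trace := by
  have h := ha.isHermitian.spectral_theorem
  set U : Matrix (Fin n) (Fin n) ℝ := ↑ha.isHermitian.eigenvectorUnitary with hU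
  have h1 : (M * a).trace = ∑ i, (Uᴴ * M * U) i i * ha.isHermitian.eigenvalues i := by
    conv_lhs => rw [h, Unitary.conjStarAlgAut_apply]
    rw [← mul_assoc, trace_mul_comm, ← mul_assoc, ← mul_assoc]
    simp [trace, mul_diagonal, hU, star_eq_conjTranspose]
  rw [h1]
  refine Finset.sum_nonneg fun i _ => mul_nonneg ?_ (ha.eigenvalues_nonneg i)
  exact (hM.conjTranspose_mul_mul_same U).diag_nonneg

lemma trace_mul_le_of_quadratic_le (hn : 1 ≤ n) {X Y : Matrix (Fin n) (Fin n) ℝ} (hX : X.IsSymm)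
    (hY : Y.IsSymm) {δ : ℝ} (hδ : 0 ≤ δ)
    (hXY : ∀ h : Fin n → ℝ, h ⬝ᵥ X *ᵥ h ≤ h ⬝ᵥ Y *ᵥ h + δ * (h ⬝ᵥ h)) {p : E n}
    {a : Matrix (Fin n) (Fin n) ℝ} (ha : a ∈ admissible n k L p) :
    (X * a).trace ≤ (Y * a).trace + δ * (n * L) := by
  have hps : (Y - X + δ • (1 : Matrix (Fin n) (Fin n) ℝ)).PosSemidef := by
    refine PosSemidef.of_dotProduct_mulVec_nonneg ?_ fun h => ?_
    · rw [IsHermitian, conjTranspose_eq_transpose_of_trivial]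
      simp [hX.eq, hY.eq]
    · have := hXY h
      simp only [star_trivial, add_mulVec, sub_mulVec, smul_mulVec, one_mulVec, dotProduct_add,
        dotProduct_sub, dotProduct_smul, smul_eq_mul]
      linarith
  have h1 := trace_mul_nonneg_of_posSemidef hps ha.1
  rw [add_mul, sub_mul, trace_add, trace_sub, smul_mul_assoc, one_mul, trace_smul,
    smul_eq_mul] at h1
  have h2 := mul_le_mul_of_nonneg_left (trace_le_of_mem_admissible hn ha) hδ
  linarith

/-- The reflection in the hyperplane orthogonal to `v`. -/
def reflMatrix (v : Fin n → ℝ) : Matrix (Fin n) (Fin n) ℝ := 1 - (2 / (v ⬝ᵥ v)) • vecMulVec v v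

lemma reflMatrix_transpose (v : Fin n → ℝ) : (reflMatrix v)ᵀ = reflMatrix v := by
  ext i j
  simp [reflMatrix, vecMulVec_apply, one_apply, mul_comm, eq_comm]

lemma reflMatrix_mulVec (v x : Fin n → ℝ) :
    reflMatrix v *ᵥ x = x - (2 / (v ⬝ᵥ v) * (v ⬝ᵥ x)) • v := by
  simp only [reflMatrix, sub_mulVec, one_mulVec, smul_mulVec, vecMulVec_mulVec]
  ext i
  simp
  ring

lemma reflMatrix_mul_self {v : Fin n → ℝ} (hv : v ⬝ᵥ v ≠ 0) : reflMatrix v * reflMatrix v = 1 := by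
  have : ∀ x, (reflMatrix v * reflMatrix v) *ᵥ x = (1 : Matrix (Fin n) (Fin n) ℝ) *ᵥ x := by
    intro x
    rw [← mulVec_mulVec, reflMatrix_mulVec, reflMatrix_mulVec, one_mulVec, dotProduct_sub,
      dotProduct_smul, smul_eq_mul]
    ext i
    simp only [Pi.sub_apply, Pi.smul_apply, smul_eq_mul]
    field_simp
    ring
  exact ext_of_mulVec_single fun i => this _

/-- This compares the constraints `a p = 0` at two nearby gradients. Reflecting along `r.1` and then
along the bisector `‖r.2‖ r.1 + ‖r.1‖ r.2` carries the line of `r.1` to that of `r.2`. At `(p, p)`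
the two reflections coincide and cancel, and the product is continuous there because `p ≠ 0`. -/
lemma exists_rotation_near_one {p : E n} (hp : p ≠ 0) {s : Set (Matrix (Fin n) (Fin n) ℝ)}
    (hs : s ∈ 𝓝 (1 : Matrix (Fin n) (Fin n) ℝ)) :
    ∀ᶠ r : E n × E n in 𝓝 (p, p), ∃ O ∈ s, Oᵀ * O = 1 ∧ ∃ t : ℝ, t ≠ 0 ∧
      Oᵀ *ᵥ r.2.ofLp = t • r.1.ofLp := by
  have hdot : ∀ x y : E n, x.ofLp ⬝ᵥ y.ofLp = inner ℝ x y := by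
    intro x y
    simp [PiLp.inner_apply, dotProduct, mul_comm]
  have hpp : p.ofLp ⬝ᵥ p.ofLp ≠ 0 := by
    rw [hdot]; exact inner_self_ne_zero.2 hp
  have hpn : ‖p‖ ≠ 0 := norm_ne_zero_iff.2 hp
  set V : E n × E n → Fin n → ℝ := fun r => ‖r.2‖ • r.1.ofLp + ‖r.1‖ • r.2.ofLp with hV
  have hVc : Continuous V := by
    apply continuous_pi
    intro i
    simp only [hV, Pi.add_apply, Pi.smul_apply, smul_eq_mul]
    fun_prop
  have hVp : V (p, p) = (2 * ‖p‖) • p.ofLp := by simp only [hV]; module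
  have hVV : V (p, p) ⬝ᵥ V (p, p) ≠ 0 := by
    rw [hVp, smul_dotProduct, dotProduct_smul, smul_eq_mul, smul_eq_mul]
    positivity
  have hdc : ∀ f : E n × E n → Fin n → ℝ, Continuous f → Continuous fun r => f r ⬝ᵥ f r :=
    fun f hf => hf.dotProduct hf
  have hrefl : ∀ f : E n × E n → Fin n → ℝ, Continuous f → f (p, p) ⬝ᵥ f (p, p) ≠ 0 →
      ContinuousAt (fun r => reflMatrix (f r)) (p, p) := by
    intro f hf h0
    unfold reflMatrix
    refine continuousAt_const.sub (ContinuousAt.fun_smul ?_ ?_)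
    · exact continuousAt_const.div (hdc f hf).continuousAt h0
    · exact (hf.matrix_vecMulVec hf).continuousAt
  have hfst : Continuous fun r : E n × E n => r.1.ofLp := by fun_prop
  have hOc : ContinuousAt (fun r : E n × E n => reflMatrix (V r) * reflMatrix r.1.ofLp) (p, p) :=
    (hrefl V hVc hVV).mul (hrefl _ hfst hpp)
  have hO1 : reflMatrix (V (p, p)) * reflMatrix p.ofLp = 1 := by
    have : reflMatrix (V (p, p)) = reflMatrix p.ofLp := by
      rw [hVp]
      ext i j
      simp only [reflMatrix, Matrix.sub_apply, Matrix.smul_apply, vecMulVec_apply,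
        Pi.smul_apply, smul_eq_mul, smul_dotProduct, dotProduct_smul]
      field_simp
    rw [this, reflMatrix_mul_self hpp]
  have h1 : ∀ᶠ r : E n × E n in 𝓝 (p, p), reflMatrix (V r) * reflMatrix r.1.ofLp ∈ s := by
    apply hOc
    simp only [hO1]
    exact hs
  have h2 : ∀ᶠ r : E n × E n in 𝓝 (p, p), V r ⬝ᵥ V r ≠ 0 :=
    (hdc V hVc).continuousAt.eventually_ne hVV
  have h3 : ∀ᶠ r : E n × E n in 𝓝 (p, p), r.1.ofLp ⬝ᵥ r.1.ofLp ≠ 0 :=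
    (hdc _ hfst).continuousAt.eventually_ne hpp
  filter_upwards [h1, h2, h3] with r hr1 hr2 hr3
  have hT : (reflMatrix (V r) * reflMatrix r.1.ofLp)ᵀ =
      reflMatrix r.1.ofLp * reflMatrix (V r) := by
    rw [transpose_mul, reflMatrix_transpose, reflMatrix_transpose]
  have hr1n : ‖r.1‖ ≠ 0 := by
    intro h0
    rw [norm_eq_zero] at h0
    simp [h0] at hr3
  have hr2n : ‖r.2‖ ≠ 0 := by
    intro h0
    have h0' := norm_eq_zero.1 h0
    simp [hV, h0'] at hr2
  refine ⟨_, hr1, ?_, ‖r.2‖ / ‖r.1‖, div_ne_zero hr2n hr1n, ?_⟩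
  · rw [hT, mul_assoc, ← mul_assoc (reflMatrix (V r)), reflMatrix_mul_self hr2, one_mul,
      reflMatrix_mul_self hr3]
  · have e11 : r.1.ofLp ⬝ᵥ r.1.ofLp = ‖r.1‖ ^ 2 := by rw [hdot, real_inner_self_eq_norm_sq]
    have e22 : r.2.ofLp ⬝ᵥ r.2.ofLp = ‖r.2‖ ^ 2 := by rw [hdot, real_inner_self_eq_norm_sq]
    have e21 : r.2.ofLp ⬝ᵥ r.1.ofLp = r.1.ofLp ⬝ᵥ r.2.ofLp := dotProduct_comm _ _
    have eVV : V r ⬝ᵥ V r =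
        2 * ‖r.1‖ * ‖r.2‖ * (‖r.1‖ * ‖r.2‖ + r.1.ofLp ⬝ᵥ r.2.ofLp) := by
      simp only [hV, add_dotProduct, dotProduct_add, smul_dotProduct, dotProduct_smul, smul_eq_mul,
        e11, e22, e21]
      ring
    have eV2 : V r ⬝ᵥ r.2.ofLp = ‖r.2‖ * (‖r.1‖ * ‖r.2‖ + r.1.ofLp ⬝ᵥ r.2.ofLp) := by
      simp only [hV, add_dotProduct, smul_dotProduct, smul_eq_mul, e22]
      ring
    have hratio : 2 / (V r ⬝ᵥ V r) * (V r ⬝ᵥ r.2.ofLp) = 1 / ‖r.1‖ := by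
      rw [eVV] at hr2
      rw [eVV, eV2]
      have hb : ‖r.1‖ * ‖r.2‖ + r.1.ofLp ⬝ᵥ r.2.ofLp ≠ 0 := fun h0 => hr2 (by rw [h0]; ring)
      field_simp
    have hstep : reflMatrix (V r) *ᵥ r.2.ofLp = -(‖r.2‖ / ‖r.1‖) • r.1.ofLp := by
      rw [reflMatrix_mulVec, hratio]
      ext i
      simp only [hV, Pi.sub_apply, Pi.smul_apply, Pi.add_apply, smul_eq_mul]
      field_simp
      ring
    rw [hT, ← mulVec_mulVec, hstep, mulVec_smul, reflMatrix_mulVec]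
    ext i
    simp only [Pi.sub_apply, Pi.smul_apply, smul_eq_mul]
    field_simp
    ring

/-- The trace is a polynomial in the entries of `O` whose coefficients are bounded by `Λ A`, so
continuity at `O = 1` is uniform in `Y` and `a`. -/
lemma eventually_trace_conj_close (Λ A : ℝ) (hΛ : 0 ≤ Λ) {η : ℝ} (hη : 0 < η) :
    ∀ᶠ O in 𝓝 (1 : Matrix (Fin n) (Fin n) ℝ), ∀ Y a : Matrix (Fin n) (Fin n) ℝ,
      (∀ i j, |Y i j| ≤ Λ) → (∀ i j, |a i j| ≤ A) →
      |(Y * (O * a * Oᵀ)).trace - (Y * a).trace| ≤ η := by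
  set I : Matrix (Fin n) (Fin n) ℝ := 1 with hI
  set c : Matrix (Fin n) (Fin n) ℝ → ℝ := fun O =>
    ∑ i, ∑ j, ∑ m, ∑ l, Λ * A * |O j l * O i m - I j l * I i m| with hc
  have hcc : Continuous c := by
    simp only [hc]
    fun_prop
  have hc1 : c I = 0 := by simp [hc]
  have hev : ∀ᶠ O in 𝓝 I, c O < η := by
    have := hcc.tendsto I
    rw [hc1] at this
    exact this.eventually_lt_const hη
  have hexp : ∀ O Y a : Matrix (Fin n) (Fin n) ℝ,
      (Y * (O * a * Oᵀ)).trace = ∑ i, ∑ j, ∑ m, ∑ l, Y i j * a l m * (O j l * O i m) := by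
    intro O Y a
    simp only [trace, diag_apply, mul_apply, transpose_apply, Finset.mul_sum, Finset.sum_mul]
    refine Finset.sum_congr rfl fun i _ => Finset.sum_congr rfl fun j _ =>
      Finset.sum_congr rfl fun m _ => Finset.sum_congr rfl fun l _ => by ring
  filter_upwards [hev] with O hO Y a hY ha
  have h1 : (Y * a).trace = (Y * (I * a * Iᵀ)).trace := by rw [hI]; simp
  rw [h1, hexp, hexp]
  refine le_trans ?_ hO.le
  simp only [hc, ← Finset.sum_sub_distrib]
  refine (Finset.abs_sum_le_sum_abs _ _).trans (Finset.sum_le_sum fun i _ => ?_)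
  refine (Finset.abs_sum_le_sum_abs _ _).trans (Finset.sum_le_sum fun j _ => ?_)
  refine (Finset.abs_sum_le_sum_abs _ _).trans (Finset.sum_le_sum fun m _ => ?_)
  refine (Finset.abs_sum_le_sum_abs _ _).trans (Finset.sum_le_sum fun l _ => ?_)
  rw [← mul_sub, abs_mul, abs_mul]
  gcongr
  · exact hY i j
  · exact ha l m

/-- Away from `p = 0`, the operator `F` is almost monotone in the Hessian, uniformly for Hessians
in a bounded set. -/
lemma F_almost_monotone (hn : 1 ≤ n) (hL : 0 ≤ L) {p : E n} (hp : p ≠ 0) {Λ η : ℝ} (hΛ : 0 ≤ Λ)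
    (hη : 0 < η) : ∃ δ > 0, ∀ p' q' : E n, dist p' p < δ → dist q' p < δ →
      ∀ X Y : Matrix (Fin n) (Fin n) ℝ, X.IsSymm → Y.IsSymm → (∀ i j, |Y i j| ≤ Λ) →
      (∀ h : Fin n → ℝ, h ⬝ᵥ X *ᵥ h ≤ h ⬝ᵥ Y *ᵥ h + δ * (h ⬝ᵥ h)) →
      0 < F n k L (q', Y) → F n k L (q', Y) ≤ F n k L (p', X) + η := by
  have hev := exists_rotation_near_one hp
    (eventually_trace_conj_close (n := n) Λ (n * L) hΛ hη)
  rw [nhds_prod_eq, Filter.eventually_prod_iff] at hev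
  obtain ⟨P, hP, Q, hQ, hPQ⟩ := hev
  obtain ⟨δ₁, hδ₁, hP⟩ := Metric.eventually_nhds_iff.1 hP
  obtain ⟨δ₂, hδ₂, hQ⟩ := Metric.eventually_nhds_iff.1 hQ
  refine ⟨min (min δ₁ δ₂) (η / (n * L + 1)), by positivity, ?_⟩
  intro p' q' hp' hq' X Y hX hY hYΛ hXY hpos
  obtain ⟨O, hO, hOO, t, ht, hOt⟩ := hPQ
    (hP (hp'.trans_le ((min_le_left _ _).trans (min_le_left _ _))))
    (hQ (hq'.trans_le ((min_le_left _ _).trans (min_le_right _ _))))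
  obtain ⟨δ, hδdef⟩ : ∃ δ, δ = min (min δ₁ δ₂) (η / (n * L + 1)) := ⟨_, rfl⟩
  rw [← hδdef] at hXY
  have hδ0 : 0 ≤ δ := by rw [hδdef]; positivity
  have hδη : δ * (n * L) ≤ η := by
    have h1 : δ ≤ η / (n * L + 1) := by rw [hδdef]; exact min_le_right _ _
    have hnL : 0 ≤ (n : ℝ) * L := by positivity
    rw [le_div_iff₀ (by positivity)] at h1
    nlinarith
  -- An empty infimum is `0` by convention, so positivity of `F (q', Y)` guarantees an admissible
  -- matrix at `q'`, which the rotation carries to `p'`.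
  have hne : (admissible n k L p').Nonempty := by
    rcases (admissible n k L q').eq_empty_or_nonempty with h1 | ⟨b, hb⟩
    · simp [F, h1] at hpos
    · exact ⟨_, admissible_conj_symm hOO ht hOt hb⟩
  have hbound : F n k L (q', Y) - η ≤ F n k L (p', X) := by
    refine le_csInf (hne.image _) ?_
    rintro _ ⟨a, ha, rfl⟩
    -- The rotated competitor is admissible at `q'`. Rotating costs at most `η/2`, and the failure
    -- of `X ≤ Y` at most `δ n L / 2 ≤ η/2`.
    have h1 := F_le hn Y (admissible_conj hOO hOt ha)
    have h2 := (abs_le.1 (hO Y a hYΛ (abs_entry_le_of_mem_admissible hn ha))).1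
    have h3 := trace_mul_le_of_quadratic_le hn hX hY hδ0 hXY ha
    simp only
    linarith
  linarith

end Operator

/-! ### From test functions to jets. -/

section Jets

open scoped RealInnerProductSpace

variable {n k : ℕ} {L : ℝ}

lemma upperEnv_eq_self {X : Type*} [TopologicalSpace X] {K : Set X} {u : X → ℝ}
    (hu : UpperSemicontinuousOn u K) {x : X} (hx : x ∈ K) : upperEnv K u x = u x := by
  have : (𝓝[K] x).NeBot := nhdsWithin_neBot_of_mem hx
  have hpure : pure x ≤ 𝓝[K] x := pure_le_nhdsWithin hx
  have hfreq : ∃ᶠ y in 𝓝[K] x, u x ≤ u y :=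
    Filter.Frequently.filter_mono (f := pure x) (by simp) hpure
  have hev : ∀ c, u x < c → ∀ᶠ y in 𝓝[K] x, u y ≤ c := fun c hc =>
    (hu x hx c hc).mono fun y hy => hy.le
  apply le_antisymm
  · refine le_of_forall_gt_imp_ge_of_dense fun c hc => ?_
    refine limsup_le_of_le ?_ (hev c hc)
    exact IsCoboundedUnder.of_frequently_ge hfreq
  · exact le_limsup_of_frequently_le hfreq
      (isBoundedUnder_of_eventually_le (hev (u x + 1) (by simp)))

lemma upperEnv_neg {X : Type*} [TopologicalSpace X] (K : Set X) (u : X → ℝ) (x : X) :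
    upperEnv K (fun y => -u y) x = - lowerEnv K u x := by
  simp only [upperEnv, lowerEnv, limsup_eq, liminf_eq, ← Real.sInf_neg]
  congr 1
  ext a
  simp only [Set.mem_neg, mem_ofPred_eq]
  constructor <;> intro h <;> filter_upwards [h] with y hy <;> linarith

lemma lowerEnv_eq_self {X : Type*} [TopologicalSpace X] {K : Set X} {u : X → ℝ}
    (hu : LowerSemicontinuousOn u K) {x : X} (hx : x ∈ K) : lowerEnv K u x = u x := by
  have h1 : UpperSemicontinuousOn (fun y => -u y) K := fun x hx c hc =>
    (hu x hx (-c) (by linarith)).mono fun y hy => by linarith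
  have := upperEnv_eq_self h1 hx
  rw [upperEnv_neg] at this
  linarith

lemma eventually_abs_F_le (hn : 1 ≤ n) (hL : 0 ≤ L) (r₀ : E n × Matrix (Fin n) (Fin n) ℝ) {ε : ℝ}
    (hε : 0 < ε) : ∀ᶠ r in 𝓝 r₀, |F n k L r| ≤ (∑ i, ∑ j, |r₀.2 i j|) * (n * L) + ε := by
  have hc : Continuous fun r : E n × Matrix (Fin n) (Fin n) ℝ =>
      (∑ i, ∑ j, |r.2 i j|) * (n * L) := by fun_prop
  have := (hc.tendsto r₀).eventually_lt_const (show _ < (∑ i, ∑ j, |r₀.2 i j|) * (n * L) + ε by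
    linarith)
  filter_upwards [this] with r hr
  exact (abs_F_le hn hL r.1 r.2).trans hr.le

lemma frequently_of_le_upperEnv_F (hn : 1 ≤ n) (hL : 0 ≤ L) {r₀ : E n × Matrix (Fin n) (Fin n) ℝ}
    (hr₀ : r₀ ∈ symDomain n) {c b : ℝ} (h : c ≤ upperEnv (symDomain n) (F n k L) r₀) (hb : b < c) :
    ∃ᶠ r in 𝓝[symDomain n] r₀, b < F n k L r := by
  have : (𝓝[symDomain n] r₀).NeBot := nhdsWithin_neBot_of_mem hr₀
  refine frequently_lt_of_lt_limsup ?_ (hb.trans_le h)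
  refine IsBoundedUnder.isCoboundedUnder_le ?_
  refine isBoundedUnder_of_eventually_ge
    (a := -((∑ i, ∑ j, |r₀.2 i j|) * (n * L) + 1)) ?_
  filter_upwards [nhdsWithin_le_nhds (eventually_abs_F_le (k := k) hn hL r₀ one_pos)] with r hr
  exact (abs_le.1 hr).1

lemma frequently_of_lowerEnv_F_le (hn : 1 ≤ n) (hL : 0 ≤ L) {r₀ : E n × Matrix (Fin n) (Fin n) ℝ}
    (hr₀ : r₀ ∈ symDomain n) {c b : ℝ} (h : lowerEnv (symDomain n) (F n k L) r₀ ≤ c) (hb : c < b) :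
    ∃ᶠ r in 𝓝[symDomain n] r₀, F n k L r < b := by
  have : (𝓝[symDomain n] r₀).NeBot := nhdsWithin_neBot_of_mem hr₀
  refine frequently_lt_of_liminf_lt ?_ (h.trans_lt hb)
  refine IsBoundedUnder.isCoboundedUnder_ge ?_
  refine isBoundedUnder_of_eventually_le
    (a := (∑ i, ∑ j, |r₀.2 i j|) * (n * L) + 1) ?_
  filter_upwards [nhdsWithin_le_nhds (eventually_abs_F_le (k := k) hn hL r₀ one_pos)] with r hr
  exact (abs_le.1 hr).2

/-- Envelope inequalities are used in the form "points with this property accumulate at `x`". That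
form passes to limits, which removes the small errors added to the Hessian of a test function. -/
lemma frequently_nhdsWithin_of_tendsto {X ι : Type*} [TopologicalSpace X] {l : Filter ι} [l.NeBot]
    {s : Set X} {P : X → Prop} {f : ι → X} {x : X} (hf : Tendsto f l (𝓝 x))
    (h : ∀ᶠ i in l, ∃ᶠ y in 𝓝[s] (f i), P y) : ∃ᶠ y in 𝓝[s] x, P y := by
  rw [frequently_iff]
  intro U hU
  rw [mem_nhdsWithin] at hU
  obtain ⟨V, hV, hxV, hVU⟩ := hU
  obtain ⟨i, hi, hiV⟩ := (h.and (hf (hV.mem_nhds hxV))).exists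
  obtain ⟨y, hy, hPy⟩ := (frequently_iff.1 hi) (mem_nhdsWithin.2 ⟨V, hV, hiV, subset_rfl⟩)
  exact ⟨y, hVU hy, hPy⟩

/-- The matrix of the bilinear form `(a, b) ↦ ⟪A a, b⟫`. -/
def formMatrix (A : E n →L[ℝ] E n) : Matrix (Fin n) (Fin n) ℝ :=
  Matrix.of fun i j => ⟪A (EuclideanSpace.single i 1), EuclideanSpace.single j 1⟫

lemma formMatrix_isSymm {A : E n →L[ℝ] E n} (hA : ∀ a b, ⟪A a, b⟫ = ⟪a, A b⟫) :
    (formMatrix A).IsSymm := by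
  ext i j
  simp only [formMatrix, Matrix.transpose_apply, Matrix.of_apply]
  rw [hA, real_inner_comm]

lemma inner_eq_sum_formMatrix (A : E n →L[ℝ] E n) (a b : E n) :
    ⟪A a, b⟫ = ∑ i, ∑ j, a i * b j * formMatrix A i j := by
  have ha : a = ∑ i, a i • EuclideanSpace.single i (1 : ℝ) := by
    have := (EuclideanSpace.basisFun (Fin n) ℝ).sum_repr a
    simpa using this.symm
  have hb : b = ∑ i, b i • EuclideanSpace.single i (1 : ℝ) := by
    have := (EuclideanSpace.basisFun (Fin n) ℝ).sum_repr b
    simpa using this.symm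
  conv_lhs => rw [ha, hb]
  simp only [map_sum, map_smul, sum_inner, inner_sum, real_inner_smul_left,
    real_inner_smul_right, formMatrix, Matrix.of_apply]
  rw [Finset.sum_comm]
  exact Finset.sum_congr rfl fun i _ => Finset.sum_congr rfl fun j _ => by ring

lemma dotProduct_formMatrix (A : E n →L[ℝ] E n) (h : E n) :
    h.ofLp ⬝ᵥ (formMatrix A).mulVec h.ofLp = ⟪A h, h⟫ := by
  rw [inner_eq_sum_formMatrix]
  simp only [dotProduct, Matrix.mulVec, Finset.mul_sum]
  exact Finset.sum_congr rfl fun i _ => Finset.sum_congr rfl fun j _ => by ring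

lemma continuous_formMatrix : Continuous (formMatrix : (E n →L[ℝ] E n) → _) := by
  refine continuous_matrix fun i j => ?_
  simp only [formMatrix, Matrix.of_apply]
  fun_prop

/-- The quartic test function with prescribed gradient `p` and Hessian `A` at `x`. -/
def quarticTest (x p : E n) (A : E n →L[ℝ] E n) (C : ℝ) (y : E n) : ℝ :=
  ⟪p, y - x⟫ + 1 / 2 * ⟪A (y - x), y - x⟫ + C * ‖y - x‖ ^ 4

lemma quarticTest_contDiff (x p : E n) (A : E n →L[ℝ] E n) (C : ℝ) :
    ContDiff ℝ 2 (quarticTest x p A C) := by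
  have h1 : ContDiff ℝ 2 fun y : E n => y - x := contDiff_id.sub contDiff_const
  have h2 : ContDiff ℝ 2 fun y : E n => (‖y - x‖ ^ 2) ^ 2 := (h1.norm_sq ℝ).pow 2
  have h3 : quarticTest x p A C = fun y => ⟪p, y - x⟫ + 1 / 2 * ⟪A (y - x), y - x⟫
      + C * (‖y - x‖ ^ 2) ^ 2 := by
    ext y; simp only [quarticTest]; ring
  rw [h3]
  exact ((contDiff_const.inner ℝ h1).add
    (contDiff_const.mul ((A.contDiff.comp h1).inner ℝ h1))).add (contDiff_const.mul h2)

lemma quarticTest_hasFDerivAt (x p : E n) {A : E n →L[ℝ] E n} (hA : ∀ a b, ⟪A a, b⟫ = ⟪a, A b⟫)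
    (C : ℝ) (y : E n) : HasFDerivAt (quarticTest x p A C)
      (innerSL ℝ (p + A (y - x) + (4 * C * ‖y - x‖ ^ 2) • (y - x))) y := by
  have h1 : HasFDerivAt (fun y : E n => y - x) (ContinuousLinearMap.id ℝ (E n)) y :=
    (hasFDerivAt_id y).sub_const x
  have h2 : HasFDerivAt (fun y : E n => A (y - x)) (A.comp (ContinuousLinearMap.id ℝ (E n))) y :=
    A.hasFDerivAt.comp y h1
  have h3 := ((((hasFDerivAt_const p y).inner ℝ h1).add
    ((h2.inner ℝ h1).const_mul (1 / 2))).add (((h1.norm_sq).pow 2).const_mul C))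
  have h4 : quarticTest x p A C = fun y => ⟪p, y - x⟫ + 1 / 2 * ⟪A (y - x), y - x⟫
      + C * (‖y - x‖ ^ 2) ^ 2 := by
    ext y; simp only [quarticTest]; ring
  rw [h4]
  refine h3.congr_fderiv ?_
  ext h
  have e : ⟪A h, y - x⟫ = ⟪A (y - x), h⟫ := by rw [hA, real_inner_comm]
  simp [-map_sub]
  rw [e]
  ring

lemma quarticTest_gradient (x p : E n) {A : E n →L[ℝ] E n} (hA : ∀ a b, ⟪A a, b⟫ = ⟪a, A b⟫)
    (C : ℝ) : gradient (quarticTest x p A C) x = p := by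
  have := quarticTest_hasFDerivAt x p hA C x
  simp only [sub_self, map_zero, add_zero, smul_zero] at this
  exact (hasGradientAt_iff_hasFDerivAt.2 this).gradient

lemma quarticTest_hessian (x p : E n) {A : E n →L[ℝ] E n} (hA : ∀ a b, ⟪A a, b⟫ = ⟪a, A b⟫)
    (C : ℝ) : hessian (quarticTest x p A C) x = formMatrix A := by
  have h0 : fderiv ℝ (quarticTest x p A C) =
      fun y => innerSL ℝ (p + A (y - x) + (4 * C * ‖y - x‖ ^ 2) • (y - x)) :=
    funext fun y => (quarticTest_hasFDerivAt x p hA C y).fderiv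
  have h1 : HasFDerivAt (fun y : E n => y - x) (ContinuousLinearMap.id ℝ (E n)) x :=
    (hasFDerivAt_id x).sub_const x
  have h2 : HasFDerivAt (fun y : E n => A (y - x)) (A.comp (ContinuousLinearMap.id ℝ (E n))) x :=
    A.hasFDerivAt.comp x h1
  have h3 := (h2.const_add p).add (((h1.norm_sq).const_mul (4 * C)).smul h1)
  have h4 := (innerSL ℝ (E := E n)).hasFDerivAt.comp x h3
  have h5 := h4.congr_of_eventuallyEq (f₁ := fderiv ℝ (quarticTest x p A C)) (.of_eq h0)
  ext i j
  simp only [hessian, formMatrix, Matrix.of_apply, h5.fderiv]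
  simp
  rfl

/-- `(p, A)` is a second order superjet of `u` at `x` relative to `K`. -/
def IsSuperjet (K : Set (E n)) (u : E n → ℝ) (x p : E n) (A : E n →L[ℝ] E n) : Prop :=
  ∀ c > 0, ∀ᶠ y in 𝓝[K] x,
    u y ≤ u x + ⟪p, y - x⟫ + 1 / 2 * ⟪A (y - x), y - x⟫ + c * ‖y - x‖ ^ 2

/-- Test functions must touch over all of `K`, whereas a jet is local. The term `δ |y - x|²` absorbs
the remainder near `x`, and a large multiple of `|y - x|⁴` dominates elsewhere without altering
gradient or Hessian at `x`. -/
lemma IsSuperjet.exists_quartic {K : Set (E n)} (hK : IsCompact K) {u : E n → ℝ} {M : ℝ}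
    (hu : ∀ y ∈ K, u y ≤ M) {x p : E n} {A : E n →L[ℝ] E n} (hj : IsSuperjet K u x p A) {δ : ℝ}
    (hδ : 0 < δ) : ∃ C, ∀ y ∈ K,
      u y ≤ u x + quarticTest x p (A + (2 * δ) • ContinuousLinearMap.id ℝ (E n)) C y := by
  have he : ∀ C y, quarticTest x p (A + (2 * δ) • ContinuousLinearMap.id ℝ (E n)) C y =
      ⟪p, y - x⟫ + 1 / 2 * ⟪A (y - x), y - x⟫ + δ * ‖y - x‖ ^ 2 + C * ‖y - x‖ ^ 4 := by
    intro C y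
    simp only [quarticTest, _root_.add_apply, _root_.smul_apply, ContinuousLinearMap.id_apply,
      inner_add_left, real_inner_smul_left, real_inner_self_eq_norm_sq]
    ring
  have hj' := hj δ hδ
  rw [eventually_nhdsWithin_iff] at hj'
  obtain ⟨r, hr, hball⟩ := Metric.eventually_nhds_iff_ball.1 hj'
  obtain ⟨D, hD⟩ := hK.bddBelow_image
    (show ContinuousOn (fun y => ⟪p, y - x⟫ + 1 / 2 * ⟪A (y - x), y - x⟫) K by fun_prop)
  set B : ℝ := |M - u x - D| with hB
  refine ⟨B / r ^ 4, fun y hy => ?_⟩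
  rw [he]
  have hBn : 0 ≤ B / r ^ 4 * ‖y - x‖ ^ 4 := by positivity
  by_cases hyr : y ∈ Metric.ball x r
  · have := hball y hyr hy
    linarith
  · rw [mem_ball_iff_norm, not_lt] at hyr
    have h1 := hu y hy
    have h2 : D ≤ ⟪p, y - x⟫ + 1 / 2 * ⟪A (y - x), y - x⟫ := hD ⟨y, hy, rfl⟩
    have h3 : B ≤ B / r ^ 4 * ‖y - x‖ ^ 4 := by
      have : r ^ 4 ≤ ‖y - x‖ ^ 4 := by gcongr
      calc B = B / r ^ 4 * r ^ 4 := by field_simp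
        _ ≤ B / r ^ 4 * ‖y - x‖ ^ 4 := by gcongr
    have h4 := le_abs_self (M - u x - D)
    have h5 : 0 ≤ δ * ‖y - x‖ ^ 2 := by positivity
    linarith

lemma symm_add_smul_id {A : E n →L[ℝ] E n} (hA : ∀ a b, ⟪A a, b⟫ = ⟪a, A b⟫) (c : ℝ) (a b : E n) :
    ⟪(A + c • ContinuousLinearMap.id ℝ (E n)) a, b⟫ =
      ⟪a, (A + c • ContinuousLinearMap.id ℝ (E n)) b⟫ := by
  simp [inner_add_left, inner_add_right, real_inner_smul_left, real_inner_smul_right, hA]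

lemma tendsto_formMatrix_add_smul_id (p : E n) (A : E n →L[ℝ] E n) (c : ℝ) :
    Tendsto (fun δ : ℝ => (p, formMatrix (A + (c * δ) • ContinuousLinearMap.id ℝ (E n)))) (𝓝[>] 0)
      (𝓝 (p, formMatrix A)) := by
  have h1 : Continuous fun δ : ℝ =>
      (p, formMatrix (A + (c * δ) • ContinuousLinearMap.id ℝ (E n))) := by
    refine continuous_const.prodMk (continuous_formMatrix.comp ?_)
    fun_prop
  have h2 := h1.tendsto 0
  rw [show A + (c * 0) • ContinuousLinearMap.id ℝ (E n) = A by
    rw [mul_zero, zero_smul ℝ (ContinuousLinearMap.id ℝ (E n)), add_zero]] at h2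
  exact h2.mono_left nhdsWithin_le_nhds

lemma SubTestAt.frequently_lt (hn : 1 ≤ n) (hL : 0 ≤ L) {K : Set (E n)} (hK : IsCompact K)
    {u : E n → ℝ} (hu : UpperSemicontinuousOn u K) {M : ℝ} (hM : ∀ y ∈ K, u y ≤ M) {x : E n}
    (hx : x ∈ K) (ht : SubTestAt k L K u x) {p : E n} {A : E n →L[ℝ] E n}
    (hA : ∀ a b, ⟪A a, b⟫ = ⟪a, A b⟫) (hj : IsSuperjet K u x p A) {b : ℝ} (hb : 1 < b) :
    ∃ᶠ r in 𝓝[symDomain n] (p, formMatrix A), F n k L r < b := by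
  refine frequently_nhdsWithin_of_tendsto (tendsto_formMatrix_add_smul_id p A 2) ?_
  filter_upwards [self_mem_nhdsWithin] with δ hδ
  obtain ⟨C, hC⟩ := hj.exists_quartic hK hM hδ
  have hA' := symm_add_smul_id hA (2 * δ)
  have := ht _ (quarticTest_contDiff x p (A + (2 * δ) • ContinuousLinearMap.id ℝ (E n)) C) (by
    intro y hy
    have h1 := hC y hy
    simp only [mem_ofPred_eq, upperEnv_eq_self hu hx, upperEnv_eq_self hu hy]
    have h2 : quarticTest x p (A + (2 * δ) • ContinuousLinearMap.id ℝ (E n)) C x = 0 := by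
      simp [quarticTest]
    linarith)
  rw [quarticTest_gradient x p hA', quarticTest_hessian x p hA'] at this
  exact frequently_of_lowerEnv_F_le hn hL (formMatrix_isSymm hA') this hb

lemma SuperTestAt.frequently_gt (hn : 1 ≤ n) (hL : 0 ≤ L) {K : Set (E n)} (hK : IsCompact K)
    {w : E n → ℝ} (hw : LowerSemicontinuousOn w K) {M : ℝ} (hM : ∀ y ∈ K, M ≤ w y) {x : E n}
    (hx : x ∈ K) (ht : SuperTestAt k L K w x) {q : E n} {A : E n →L[ℝ] E n}
    (hA : ∀ a b, ⟪A a, b⟫ = ⟪a, A b⟫) (hj : IsSuperjet K (fun y => -w y) x (-q) (-A)) {b : ℝ}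
    (hb : b < 1) : ∃ᶠ r in 𝓝[symDomain n] (q, formMatrix A), b < F n k L r := by
  refine frequently_nhdsWithin_of_tendsto (tendsto_formMatrix_add_smul_id q A (-2)) ?_
  filter_upwards [self_mem_nhdsWithin] with δ hδ
  obtain ⟨C, hC⟩ := hj.exists_quartic hK (M := -M) (fun y hy => neg_le_neg (hM y hy)) hδ
  have hA' := symm_add_smul_id hA (-2 * δ)
  have hneg : ∀ y, quarticTest x (-q) (-A + (2 * δ) • ContinuousLinearMap.id ℝ (E n)) C y =
      - quarticTest x q (A + (-2 * δ) • ContinuousLinearMap.id ℝ (E n)) (-C) y := by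
    intro y
    simp [-map_sub, quarticTest, inner_add_left, real_inner_smul_left]
    ring
  have := ht _ (quarticTest_contDiff x q (A + (-2 * δ) • ContinuousLinearMap.id ℝ (E n)) (-C)) (by
    intro y hy
    have h1 := hC y hy
    rw [hneg] at h1
    simp only [mem_ofPred_eq, lowerEnv_eq_self hw hx, lowerEnv_eq_self hw hy]
    have h2 : quarticTest x q (A + (-2 * δ) • ContinuousLinearMap.id ℝ (E n)) (-C) x = 0 := by
      simp [quarticTest]
    linarith)
  rw [quarticTest_gradient x q hA', quarticTest_hessian x q hA'] at this
  exact frequently_of_le_upperEnv_F hn hL (formMatrix_isSymm hA') this hb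

end Jets

/-! ### Sup-convolutions and the theorem on sums. -/

section Sums

open scoped RealInnerProductSpace
open Asymptotics

variable {G : Type*} [NormedAddCommGroup G]

/-- Existence of the sup-convolution `V` of `U` over `K` with parameter `c`, together with a choice
`s` of points where the supremum is attained. -/
lemma exists_supConvolution {K : Set G} (hK : IsCompact K) (hne : K.Nonempty) {U : G → ℝ}
    (hU : UpperSemicontinuousOn U K) (c : ℝ) : ∃ (V : G → ℝ) (s : G → G),
      (∀ ξ, s ξ ∈ K) ∧ (∀ ξ, V ξ = U (s ξ) - c / 2 * ‖ξ - s ξ‖ ^ 2) ∧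
      ∀ ξ, ∀ x ∈ K, U x - c / 2 * ‖ξ - x‖ ^ 2 ≤ V ξ := by
  have : ∀ ξ : G, ∃ x ∈ K, ∀ y ∈ K, U y - c / 2 * ‖ξ - y‖ ^ 2 ≤ U x - c / 2 * ‖ξ - x‖ ^ 2 := by
    intro ξ
    have h1 : UpperSemicontinuousOn (fun x => U x + -(c / 2 * ‖ξ - x‖ ^ 2)) K :=
      hU.add (ContinuousOn.upperSemicontinuousOn (by fun_prop))
    obtain ⟨x, hx, hmax⟩ := h1.exists_isMaxOn hne hK
    refine ⟨x, hx, fun y hy => ?_⟩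
    have := hmax hy
    simp only [mem_ofPred_eq] at this
    linarith
  choose s hs hmax using this
  exact ⟨fun ξ => U (s ξ) - c / 2 * ‖ξ - s ξ‖ ^ 2, s, hs, fun ξ => rfl, hmax⟩

variable [InnerProductSpace ℝ G]

lemma supConvolution_hasSubgrads {K : Set G} {U V : G → ℝ} {s : G → G} {c : ℝ}
    (hs : ∀ ξ, s ξ ∈ K) (hV : ∀ ξ, V ξ = U (s ξ) - c / 2 * ‖ξ - s ξ‖ ^ 2)
    (hmax : ∀ ξ, ∀ x ∈ K, U x - c / 2 * ‖ξ - x‖ ^ 2 ≤ V ξ) : HasSubgrads V (-c) := by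
  intro ξ
  refine ⟨c • (s ξ - ξ), fun h => ?_⟩
  have h1 := hmax (ξ + h) (s ξ) (hs ξ)
  have e : ‖ξ + h - s ξ‖ ^ 2 = ‖ξ - s ξ‖ ^ 2 - 2 * ⟪s ξ - ξ, h⟫ + ‖h‖ ^ 2 := by
    rw [show ξ + h - s ξ = (ξ - s ξ) + h by abel, norm_add_sq_real,
      show s ξ - ξ = -(ξ - s ξ) by abel, inner_neg_left]
    ring
  rw [e] at h1
  rw [hV, real_inner_smul_left]
  linarith

variable [FiniteDimensional ℝ G]

/-- The theorem on sums for semiconvex functions: near a local maximum of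
`V₁(x) + V₂(y) - ⟪p, x - y⟫ - C/2 |x - y - ζ|²` both functions have second order expansions whose
Hessians are almost ordered. -/
theorem exists_expansions_near_max {V₁ V₂ : G → ℝ} {c C : ℝ} (hc : 0 ≤ c) (hC : 0 ≤ C)
    (h₁ : HasSubgrads V₁ (-c)) (h₂ : HasSubgrads V₂ (-c)) {p z₁ z₂ : G}
    (hmax : IsLocalMax (fun z : G × G => V₁ z.1 + V₂ z.2 - ⟪p, z.1 - z.2⟫
      - C / 2 * ‖z.1 - z.2 - (z₁ - z₂)‖ ^ 2) (z₁, z₂)) {δ : ℝ} (hδ : 0 < δ) :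
    ∃ (ξ η p₁ p₂ : G) (A₁ A₂ : G →L[ℝ] G), ‖ξ - z₁‖ < δ ∧ ‖η - z₂‖ < δ ∧ ‖p₁ - p‖ < δ ∧
      ‖p₂ + p‖ < δ ∧ (∀ a b, ⟪A₁ a, b⟫ = ⟪a, A₁ b⟫) ∧ (∀ a b, ⟪A₂ a, b⟫ = ⟪a, A₂ b⟫) ∧
      (∀ h, ⟪A₁ h, h⟫ + ⟪A₂ h, h⟫ ≤ 2 * δ * ‖h‖ ^ 2) ∧
      (∀ h, ⟪A₂ h, h⟫ ≤ (δ + C) * ‖h‖ ^ 2) ∧ (∀ h, -(c + C) * ‖h‖ ^ 2 ≤ ⟪A₂ h, h⟫) ∧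
      (fun h => V₁ (ξ + h) - V₁ ξ - ⟪p₁, h⟫ - 1 / 2 * ⟪A₁ h, h⟫) =o[𝓝 0] (fun h => ‖h‖ ^ 2) ∧
      (fun h => V₂ (η + h) - V₂ η - ⟪p₂, h⟫ - 1 / 2 * ⟪A₂ h, h⟫) =o[𝓝 0] (fun h => ‖h‖ ^ 2) := by
  set e := WithLp.prodContinuousLinearEquiv 2 ℝ G G with he
  have hinner : ∀ a b : WithLp 2 (G × G), ⟪a, b⟫ = ⟪a.fst, b.fst⟫ + ⟪a.snd, b.snd⟫ :=
    fun a b => WithLp.prod_inner_apply a b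
  have hnorm : ∀ a : WithLp 2 (G × G), ‖a‖ ^ 2 = ‖a.fst‖ ^ 2 + ‖a.snd‖ ^ 2 :=
    fun a => WithLp.prod_norm_sq_eq_of_L2 a
  set g : WithLp 2 (G × G) → ℝ := fun z => V₁ z.fst + V₂ z.snd - ⟪p, z.fst - z.snd⟫
      - C / 2 * ‖z.fst - z.snd - (z₁ - z₂)‖ ^ 2 with hg
  have hsq : ∀ d a : G, ‖d + a‖ ^ 2 = ‖d‖ ^ 2 + 2 * ⟪d, a⟫ + ‖a‖ ^ 2 :=
    fun d a => norm_add_sq_real d a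
  -- The penalty costs `2 C` of semiconvexity because `|a - b|² ≤ 2 (|a|² + |b|²)`.
  have hgs : HasSubgrads g (-(c + 2 * C)) := by
    intro z
    obtain ⟨q₁, hq₁⟩ := h₁ z.fst
    obtain ⟨q₂, hq₂⟩ := h₂ z.snd
    set d := z.fst - z.snd - (z₁ - z₂) with hd
    refine ⟨WithLp.toLp 2 (q₁ - p - C • d, q₂ + p + C • d), fun h => ?_⟩
    have a1 := hq₁ h.fst
    have a2 := hq₂ h.snd
    have e1 : (z + h).fst - (z + h).snd - (z₁ - z₂) = d + (h.fst - h.snd) := by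
      rw [WithLp.add_fst, WithLp.add_snd, hd]; abel
    have e2 : (z + h).fst - (z + h).snd = (z.fst - z.snd) + (h.fst - h.snd) := by
      rw [WithLp.add_fst, WithLp.add_snd]; abel
    have e3 : ‖h.fst - h.snd‖ ^ 2 ≤ 2 * (‖h.fst‖ ^ 2 + ‖h.snd‖ ^ 2) := by
      have := parallelogram_law_with_norm ℝ h.fst h.snd
      nlinarith [sq_nonneg ‖h.fst + h.snd‖]
    have e4 : C * ‖h.fst - h.snd‖ ^ 2 ≤ C * (2 * (‖h.fst‖ ^ 2 + ‖h.snd‖ ^ 2)) :=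
      mul_le_mul_of_nonneg_left e3 hC
    simp only [hg, e1]
    rw [e2, hsq, hinner, hnorm, WithLp.add_fst, WithLp.add_snd]
    simp only [inner_sub_left, inner_add_left, inner_sub_right, inner_add_right,
      real_inner_smul_left, WithLp.toLp_fst, WithLp.toLp_snd]
    rw [← hd]
    linarith
  have hgmax : IsLocalMax g (e.symm (z₁, z₂)) := by
    have ht : Tendsto e (𝓝 (e.symm (z₁, z₂))) (𝓝 (z₁, z₂)) := by
      have := e.continuous.tendsto (e.symm (z₁, z₂))
      rwa [e.apply_symm_apply] at this
    exact ht.eventually hmax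
  -- The penalty has gradient `C d` with `|d| ≤ 2 δ'`, so the slopes are off by at most `δ' + 2 C δ'
  -- = δ`.
  set δ' : ℝ := δ / (1 + 2 * C) with hδ'
  have hδ'pos : 0 < δ' := by positivity
  have hδ'C : δ' * (1 + 2 * C) = δ := by rw [hδ']; field_simp
  have hδ'le : δ' ≤ δ := by nlinarith
  obtain ⟨z, P, X, hz, hP, hXs, hXup, hXlow, hXe⟩ :=
    hgs.exists_expansion_near_max (by positivity) hgmax hδ'pos
  have hfst : ∀ a : WithLp 2 (G × G), ‖a.fst‖ ≤ ‖a‖ := fun a =>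
    le_of_sq_le_sq (by rw [hnorm]; nlinarith [sq_nonneg ‖a.snd‖]) (norm_nonneg _)
  have hsnd : ∀ a : WithLp 2 (G × G), ‖a.snd‖ ≤ ‖a‖ := fun a =>
    le_of_sq_le_sq (by rw [hnorm]; nlinarith [sq_nonneg ‖a.fst‖]) (norm_nonneg _)
  have hz1 : ‖z.fst - z₁‖ < δ' := (hfst (z - e.symm (z₁, z₂))).trans_lt hz
  have hz2 : ‖z.snd - z₂‖ < δ' := (hsnd (z - e.symm (z₁, z₂))).trans_lt hz
  set d : G := z.fst - z.snd - (z₁ - z₂) with hd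
  have hdn : ‖d‖ ≤ 2 * δ' := by
    rw [hd, show z.fst - z.snd - (z₁ - z₂) = (z.fst - z₁) - (z.snd - z₂) by abel]
    exact (norm_sub_le _ _).trans (by linarith)
  have hCd : ‖C • d‖ ≤ C * (2 * δ') := by
    rw [norm_smul, Real.norm_eq_abs, abs_of_nonneg hC]
    gcongr
  -- coordinate embeddings
  set i₁ : G →L[ℝ] WithLp 2 (G × G) :=
    (e.symm : (G × G) →L[ℝ] WithLp 2 (G × G)).comp (ContinuousLinearMap.inl ℝ G G) with hi₁
  set i₂ : G →L[ℝ] WithLp 2 (G × G) :=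
    (e.symm : (G × G) →L[ℝ] WithLp 2 (G × G)).comp (ContinuousLinearMap.inr ℝ G G) with hi₂
  set π₁ : WithLp 2 (G × G) →L[ℝ] G :=
    (ContinuousLinearMap.fst ℝ G G).comp (e : WithLp 2 (G × G) →L[ℝ] G × G) with hπ₁
  set π₂ : WithLp 2 (G × G) →L[ℝ] G :=
    (ContinuousLinearMap.snd ℝ G G).comp (e : WithLp 2 (G × G) →L[ℝ] G × G) with hπ₂
  have i11 : ∀ h, (i₁ h).fst = h := fun h => rfl
  have i12 : ∀ h, (i₁ h).snd = 0 := fun h => rfl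
  have i21 : ∀ h, (i₂ h).fst = 0 := fun h => rfl
  have i22 : ∀ h, (i₂ h).snd = h := fun h => rfl
  have hπi₁ : ∀ a b, ⟪π₁ a, b⟫ = ⟪a, i₁ b⟫ := by
    intro a b; rw [hinner, i11, i12, inner_zero_right, add_zero]; rfl
  have hπi₂ : ∀ a b, ⟪π₂ a, b⟫ = ⟪a, i₂ b⟫ := by
    intro a b; rw [hinner, i21, i22, inner_zero_right, zero_add]; rfl
  have hn₁ : ∀ h, ‖i₁ h‖ ^ 2 = ‖h‖ ^ 2 := by intro h; rw [hnorm, i11, i12]; simp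
  have hn₂ : ∀ h, ‖i₂ h‖ ^ 2 = ‖h‖ ^ 2 := by intro h; rw [hnorm, i21, i22]; simp
  have hn₁₂ : ∀ h, ‖i₁ h + i₂ h‖ ^ 2 = 2 * ‖h‖ ^ 2 := by
    intro h
    rw [hnorm, WithLp.add_fst, WithLp.add_snd, i11, i12, i21, i22, add_zero, zero_add]; ring
  -- The Hessian of each summand is a diagonal block of `X`, corrected by the Hessian `C` of the
  -- penalty.
  set A₁ : G →L[ℝ] G := π₁.comp (X.comp i₁) + C • ContinuousLinearMap.id ℝ G with hA₁
  set A₂ : G →L[ℝ] G := π₂.comp (X.comp i₂) + C • ContinuousLinearMap.id ℝ G with hA₂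
  have hA₁i : ∀ a b, ⟪A₁ a, b⟫ = ⟪X (i₁ a), i₁ b⟫ + C * ⟪a, b⟫ := by
    intro a b
    simp only [hA₁, _root_.add_apply, _root_.smul_apply, ContinuousLinearMap.comp_apply,
      ContinuousLinearMap.id_apply, inner_add_left, real_inner_smul_left, hπi₁]
  have hA₂i : ∀ a b, ⟪A₂ a, b⟫ = ⟪X (i₂ a), i₂ b⟫ + C * ⟪a, b⟫ := by
    intro a b
    simp only [hA₂, _root_.add_apply, _root_.smul_apply, ContinuousLinearMap.comp_apply,
      ContinuousLinearMap.id_apply, inner_add_left, real_inner_smul_left, hπi₂]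
  have hzero : ∀ i : G →L[ℝ] WithLp 2 (G × G), Tendsto i (𝓝 0) (𝓝 0) := by
    intro i
    have := i.continuous.tendsto 0
    rwa [map_zero] at this
  have hr₁ : (fun h => V₁ (z.fst + h) - V₁ z.fst - ⟪p + P.fst + C • d, h⟫ - 1 / 2 * ⟪A₁ h, h⟫)
      =o[𝓝 0] (fun h => ‖h‖ ^ 2) := by
    have h1 := hXe.comp_tendsto (hzero i₁)
    refine (h1.congr_right fun h => hn₁ h).congr_left fun h => ?_
    have e1 : (z + i₁ h).fst - (z + i₁ h).snd - (z₁ - z₂) = d + h := by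
      rw [WithLp.add_fst, WithLp.add_snd, i11, i12, hd]; abel
    have e2 : (z + i₁ h).fst - (z + i₁ h).snd = (z.fst - z.snd) + h := by
      rw [WithLp.add_fst, WithLp.add_snd, i11, i12]; abel
    simp only [Function.comp_apply, hg, e1]
    rw [e2, hsq, hinner P, i11, i12, inner_zero_right, WithLp.add_fst, WithLp.add_snd, i11, i12,
      add_zero, hA₁i, ← hd, real_inner_self_eq_norm_sq]
    simp only [inner_add_left, inner_add_right, real_inner_smul_left]
    ring
  have hr₂ : (fun h => V₂ (z.snd + h) - V₂ z.snd - ⟪-p + P.snd - C • d, h⟫ - 1 / 2 * ⟪A₂ h, h⟫)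
      =o[𝓝 0] (fun h => ‖h‖ ^ 2) := by
    have h1 := hXe.comp_tendsto (hzero i₂)
    refine (h1.congr_right fun h => hn₂ h).congr_left fun h => ?_
    have e1 : (z + i₂ h).fst - (z + i₂ h).snd - (z₁ - z₂) = d + -h := by
      rw [WithLp.add_fst, WithLp.add_snd, i21, i22, hd]; abel
    have e2 : (z + i₂ h).fst - (z + i₂ h).snd = (z.fst - z.snd) - h := by
      rw [WithLp.add_fst, WithLp.add_snd, i21, i22]; abel
    simp only [Function.comp_apply, hg, e1]
    rw [e2, hsq, hinner P, i21, i22, inner_zero_right, WithLp.add_fst, WithLp.add_snd, i21, i22,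
      add_zero, hA₂i, ← hd, real_inner_self_eq_norm_sq]
    simp only [inner_add_left, inner_sub_left, inner_sub_right, inner_neg_left, inner_neg_right,
      real_inner_smul_left, norm_neg]
    ring
  -- Along the diagonal `(h, h)` the difference of the variables, hence the penalty, is constant.
  -- There `g` varies as `V₁ + V₂`.
  have hsum : ∀ h, ⟪A₁ h, h⟫ + ⟪A₂ h, h⟫ ≤ ⟪X (i₁ h + i₂ h), i₁ h + i₂ h⟫ := by
    intro h
    have h3 : (fun h => g (z + (i₁ h + i₂ h)) - g z - ⟪P, i₁ h + i₂ h⟫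
        - 1 / 2 * ⟪X (i₁ h + i₂ h), i₁ h + i₂ h⟫) =o[𝓝 0] (fun h => ‖h‖ ^ 2) := by
      have h1 := hXe.comp_tendsto (hzero (i₁ + i₂))
      refine h1.trans_isBigO (IsBigO.of_bound 2 (Eventually.of_forall fun h => ?_))
      simp only [Function.comp_apply, _root_.add_apply, hn₁₂]
      simp
    have h4 := ((h3.sub hr₁).sub hr₂).const_mul_left 2
    have := le_zero_of_eventually_le_isLittleO
      (Q := fun h => ⟪A₁ h, h⟫ + ⟪A₂ h, h⟫ - ⟪X (i₁ h + i₂ h), i₁ h + i₂ h⟫) (by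
        intro t h
        simp only [map_smul, ← smul_add, real_inner_smul_left, real_inner_smul_right]
        ring) h4 (Eventually.of_forall fun h => by
        have e1 : (z + (i₁ h + i₂ h)).fst = z.fst + h := by
          simp only [WithLp.add_fst, i11, i21, add_zero]
        have e2 : (z + (i₁ h + i₂ h)).snd = z.snd + h := by
          simp only [WithLp.add_snd, i12, i22, zero_add]
        have e3 : ⟪P, i₁ h + i₂ h⟫ = ⟪P.fst, h⟫ + ⟪P.snd, h⟫ := by
          rw [hinner, WithLp.add_fst, WithLp.add_snd, i11, i12, i21, i22, add_zero, zero_add]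
        simp only [hg, e1, e2, e3, add_sub_add_right_eq_sub, inner_add_left, inner_sub_left,
          inner_neg_left, real_inner_smul_left]
        apply le_of_eq
        ring) h
    linarith
  refine ⟨z.fst, z.snd, p + P.fst + C • d, -p + P.snd - C • d, A₁, A₂, hz1.trans_le hδ'le,
    hz2.trans_le hδ'le, ?_, ?_, ?_, ?_, ?_, ?_, ?_, hr₁, hr₂⟩
  · rw [show p + P.fst + C • d - p = P.fst + C • d by abel]
    calc _ ≤ ‖P.fst‖ + ‖C • d‖ := norm_add_le _ _
      _ < δ' + C * (2 * δ') := add_lt_add_of_lt_of_le ((hfst P).trans_lt hP) hCd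
      _ = δ := by rw [← hδ'C]; ring
  · rw [show -p + P.snd - C • d + p = P.snd - C • d by abel]
    calc _ ≤ ‖P.snd‖ + ‖C • d‖ := norm_sub_le _ _
      _ < δ' + C * (2 * δ') := add_lt_add_of_lt_of_le ((hsnd P).trans_lt hP) hCd
      _ = δ := by rw [← hδ'C]; ring
  · intro a b
    rw [hA₁i, hXs, real_inner_comm (A₁ b) a, hA₁i, real_inner_comm (X (i₁ b)) (i₁ a),
      real_inner_comm b a]
  · intro a b
    rw [hA₂i, hXs, real_inner_comm (A₂ b) a, hA₂i, real_inner_comm (X (i₂ b)) (i₂ a),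
      real_inner_comm b a]
  · intro h
    have := (hsum h).trans (hXup (i₁ h + i₂ h))
    rw [hn₁₂] at this
    nlinarith [sq_nonneg ‖h‖]
  · intro h
    have := hXup (i₂ h)
    rw [hn₂] at this
    rw [hA₂i, real_inner_self_eq_norm_sq]
    nlinarith [sq_nonneg ‖h‖]
  · intro h
    have := hXlow (i₂ h)
    rw [hn₂] at this
    rw [hA₂i, real_inner_self_eq_norm_sq]
    linarith

end Sums

/-! ### Doubling of variables for a strict supersolution. -/

section Core

open scoped RealInnerProductSpace
open Asymptotics

variable {n k : ℕ} {L : ℝ}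

/-- Shifting `ξ` and the competitor by the same vector leaves the quadratic cost unchanged, so `U`
near `s ξ` lies below the translated graph of `V` near `ξ`. The jet passes to `s ξ` with the same
`p` and `A`. -/
lemma supConvolution_isSuperjet {K : Set (E n)} {U V : E n → ℝ} {s : E n → E n} {c : ℝ}
    (hV : ∀ ξ, V ξ = U (s ξ) - c / 2 * ‖ξ - s ξ‖ ^ 2)
    (hmax : ∀ ξ, ∀ x ∈ K, U x - c / 2 * ‖ξ - x‖ ^ 2 ≤ V ξ) {ξ p : E n} {A : E n →L[ℝ] E n}
    (he : (fun h => V (ξ + h) - V ξ - ⟪p, h⟫ - 1 / 2 * ⟪A h, h⟫) =o[𝓝 0] (fun h => ‖h‖ ^ 2)) :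
    IsSuperjet K U (s ξ) p A := by
  intro b hb
  have ht : Tendsto (fun y => y - s ξ) (𝓝[K] (s ξ)) (𝓝 0) := by
    have : Tendsto (fun y => y - s ξ) (𝓝 (s ξ)) (𝓝 (s ξ - s ξ)) :=
      Continuous.tendsto (by fun_prop) _
    rw [sub_self] at this
    exact this.mono_left nhdsWithin_le_nhds
  filter_upwards [ht.eventually (he.bound hb), self_mem_nhdsWithin] with y hy hyK
  rw [norm_pow, norm_norm, Real.norm_eq_abs] at hy
  have h1 := (abs_le.1 hy).2
  have h2 := hmax (ξ + (y - s ξ)) y hyK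
  rw [show ξ + (y - s ξ) - y = ξ - s ξ by abel] at h2
  have h3 := hV ξ
  linarith

lemma quartic_le (α : ℝ) (hα : 0 ≤ α) (ζ : E n) : ∃ C, 0 ≤ C ∧ ∀ᶠ ζ' in 𝓝 ζ,
    α * ‖ζ'‖ ^ 4 ≤ α * ‖ζ‖ ^ 4 + ⟪(4 * α * ‖ζ‖ ^ 2) • ζ, ζ' - ζ⟫ + C / 2 * ‖ζ' - ζ‖ ^ 2 := by
  set B : ℝ := 2 * ‖ζ‖ ^ 2 + (2 * ‖ζ‖ + 1) ^ 2 with hB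
  refine ⟨2 * (α * B), by positivity, ?_⟩
  filter_upwards [Metric.ball_mem_nhds ζ one_pos] with ζ' hζ'
  rw [mem_ball_iff_norm] at hζ'
  obtain ⟨h, rfl⟩ : ∃ h, ζ' = ζ + h := ⟨ζ' - ζ, by abel⟩
  rw [add_sub_cancel_left] at hζ' ⊢
  have e : ‖ζ + h‖ ^ 4 = (‖ζ‖ ^ 2 + 2 * ⟪ζ, h⟫ + ‖h‖ ^ 2) ^ 2 := by
    rw [← norm_add_sq_real]; ring
  have h1 : |2 * ⟪ζ, h⟫ + ‖h‖ ^ 2| ≤ (2 * ‖ζ‖ + 1) * ‖h‖ := by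
    have h2 := abs_real_inner_le_norm ζ h
    have h3 : ‖h‖ ^ 2 ≤ ‖h‖ := by nlinarith [norm_nonneg h]
    calc |2 * ⟪ζ, h⟫ + ‖h‖ ^ 2| ≤ |2 * ⟪ζ, h⟫| + |‖h‖ ^ 2| := abs_add_le _ _
      _ = 2 * |⟪ζ, h⟫| + ‖h‖ ^ 2 := by rw [abs_mul, abs_two, abs_of_nonneg (sq_nonneg ‖h‖)]
      _ ≤ (2 * ‖ζ‖ + 1) * ‖h‖ := by linarith
  have h4 : (2 * ⟪ζ, h⟫ + ‖h‖ ^ 2) ^ 2 ≤ (2 * ‖ζ‖ + 1) ^ 2 * ‖h‖ ^ 2 := by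
    rw [← sq_abs, ← mul_pow]
    gcongr
  have h5 : ‖ζ + h‖ ^ 4 ≤ ‖ζ‖ ^ 4 + 4 * ‖ζ‖ ^ 2 * ⟪ζ, h⟫ + B * ‖h‖ ^ 2 := by
    rw [e, hB]; nlinarith
  rw [real_inner_smul_left]
  have := mul_le_mul_of_nonneg_left h5 hα
  linarith

/-- At the origin the quadratic majorant may have arbitrarily small opening. This is why the penalty
is quartic. -/
lemma quartic_le_zero (α : ℝ) {C : ℝ} (hC : 0 < C) :
    ∀ᶠ ζ' in 𝓝 (0 : E n), α * ‖ζ'‖ ^ 4 ≤ C / 2 * ‖ζ'‖ ^ 2 := by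
  have : Tendsto (fun ζ : E n => α * ‖ζ‖ ^ 2) (𝓝 0) (𝓝 (α * ‖(0 : E n)‖ ^ 2)) :=
    Continuous.tendsto (by fun_prop) 0
  rw [norm_zero, zero_pow two_ne_zero, mul_zero] at this
  filter_upwards [this.eventually_lt_const (half_pos hC)] with ζ hζ
  have := mul_le_mul_of_nonneg_right hζ.le (sq_nonneg ‖ζ‖)
  linarith

lemma exists_near_of_frequently {r₀ : E n × Matrix (Fin n) (Fin n) ℝ}
    {P : E n × Matrix (Fin n) (Fin n) ℝ → Prop} (h : ∃ᶠ r in 𝓝[symDomain n] r₀, P r) {δ : ℝ}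
    (hδ : 0 < δ) : ∃ r : E n × Matrix (Fin n) (Fin n) ℝ, P r ∧ r.2.IsSymm ∧ dist r.1 r₀.1 < δ ∧
      ∀ i j, |r.2 i j - r₀.2 i j| < δ := by
  have h1 : ∀ᶠ r in 𝓝 r₀, dist r.1 r₀.1 < δ :=
    continuous_fst.continuousAt.eventually (Metric.ball_mem_nhds r₀.1 hδ)
  have h2 : ∀ᶠ r in 𝓝 r₀, ∀ i j, |r.2 i j - r₀.2 i j| < δ := by
    refine eventually_all.2 fun i => eventually_all.2 fun j => ?_
    have hc : Continuous fun r : E n × Matrix (Fin n) (Fin n) ℝ => r.2 i j := by fun_prop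
    exact hc.continuousAt.eventually (Metric.ball_mem_nhds (r₀.2 i j) hδ)
  obtain ⟨r, hPr, hr1, hr2, hr3⟩ := (h.and_eventually
    ((eventually_nhdsWithin_of_eventually_nhds h1).and
      ((eventually_nhdsWithin_of_eventually_nhds h2).and self_mem_nhdsWithin))).exists
  exact ⟨r, hPr, hr3, hr1, hr2⟩

lemma abs_quadratic_sub_le {X Z : Matrix (Fin n) (Fin n) ℝ} {δ : ℝ}
    (hXZ : ∀ i j, |X i j - Z i j| < δ) (h : Fin n → ℝ) :
    |h ⬝ᵥ X.mulVec h - h ⬝ᵥ Z.mulVec h| ≤ n * δ * (h ⬝ᵥ h) := by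
  have e : h ⬝ᵥ X.mulVec h - h ⬝ᵥ Z.mulVec h = ∑ i, ∑ j, h i * h j * (X i j - Z i j) := by
    simp only [dotProduct, Matrix.mulVec, Finset.mul_sum, ← Finset.sum_sub_distrib]
    exact Finset.sum_congr rfl fun i _ => Finset.sum_congr rfl fun j _ => by ring
  rw [e]
  have hδ : ∀ i j, |h i * h j * (X i j - Z i j)| ≤ (h i * h i + h j * h j) / 2 * δ := by
    intro i j
    have h0 : 0 ≤ δ := (abs_nonneg _).trans (hXZ i j).le
    rw [abs_mul]
    refine mul_le_mul ?_ (hXZ i j).le (abs_nonneg _)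
      (by linarith [mul_self_nonneg (h i), mul_self_nonneg (h j)])
    rw [abs_le]
    constructor <;> nlinarith [sq_nonneg (h i + h j), sq_nonneg (h i - h j)]
  calc |∑ i, ∑ j, h i * h j * (X i j - Z i j)|
      ≤ ∑ i, ∑ j, |h i * h j * (X i j - Z i j)| :=
        (Finset.abs_sum_le_sum_abs _ _).trans
          (Finset.sum_le_sum fun i _ => Finset.abs_sum_le_sum_abs _ _)
    _ ≤ ∑ i, ∑ j, (h i * h i + h j * h j) / 2 * δ :=
        Finset.sum_le_sum fun i _ => Finset.sum_le_sum fun j _ => hδ i j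
    _ = n * δ * (h ⬝ᵥ h) := by
        simp only [← Finset.sum_mul, ← Finset.sum_div, Finset.sum_add_distrib, dotProduct,
          Finset.sum_const, Finset.card_univ, Fintype.card_fin, nsmul_eq_mul]
        simp only [mul_assoc (n : ℝ), ← Finset.mul_sum]
        ring

lemma abs_formMatrix_le {A : E n →L[ℝ] E n} (hA : ∀ a b, ⟪A a, b⟫ = ⟪a, A b⟫) {B : ℝ}
    (hup : ∀ h, ⟪A h, h⟫ ≤ B * ‖h‖ ^ 2) (hlow : ∀ h, -B * ‖h‖ ^ 2 ≤ ⟪A h, h⟫) (i j : Fin n) :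
    |formMatrix A i j| ≤ B := by
  set a : E n := EuclideanSpace.single i 1 with ha
  set b : E n := EuclideanSpace.single j 1 with hb
  have hna : ‖a‖ = 1 := by simp [ha]
  have hnb : ‖b‖ = 1 := by simp [hb]
  have e : formMatrix A i j = ⟪A a, b⟫ := rfl
  have e2 : ⟪A b, a⟫ = ⟪A a, b⟫ := by rw [hA, real_inner_comm]
  have h1 := hup (a + b)
  have h2 := hlow (a + b)
  have h3 := hup (a - b)
  have h4 := hlow (a - b)
  have hp := parallelogram_law_with_norm ℝ a b
  rw [hna, hnb] at hp
  simp only [map_add, map_sub, inner_add_left, inner_add_right, inner_sub_left, inner_sub_right,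
    e2] at h1 h2 h3 h4
  have hp' : B * (‖a + b‖ ^ 2 + ‖a - b‖ ^ 2) = 4 * B := by
    rw [show ‖a + b‖ ^ 2 + ‖a - b‖ ^ 2 = 4 by nlinarith]; ring
  rw [e, abs_le]
  constructor <;> linarith

/-- It handles the singular gradient: the bound holds whatever `q` is, so no continuity of `F` at
`0` in the gradient is needed. -/
lemma F_le_of_quadratic_ge (hn : 1 ≤ n) (hL : 0 ≤ L) {q : E n} {Y : Matrix (Fin n) (Fin n) ℝ}
    (hY : Y.IsSymm) {ε : ℝ} (hε : 0 ≤ ε)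
    (h : ∀ h : Fin n → ℝ, 0 ≤ h ⬝ᵥ Y.mulVec h + ε * (h ⬝ᵥ h)) :
    F n k L (q, Y) ≤ ε * (n * L) := by
  have hnn : 0 ≤ ε * (n * L) := by positivity
  rcases (admissible n k L q).eq_empty_or_nonempty with h0 | ⟨a, ha⟩
  · simpa [F, h0] using hnn
  · have h1 := F_le hn Y ha
    have h2 := trace_mul_le_of_quadratic_le hn (X := 0) Matrix.isSymm_zero hY hε
      (fun x => by simpa using h x) ha
    rw [zero_mul, Matrix.trace_zero] at h2
    linarith

lemma dotProduct_self_ofLp (x : Fin n → ℝ) : x ⬝ᵥ x = ‖(WithLp.toLp 2 x : E n)‖ ^ 2 := by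
  rw [EuclideanSpace.norm_sq_eq]
  simp [dotProduct, sq]

/-- Comparison on nested domains for a subsolution and a strict nonnegative supersolution, in terms
of jets. -/
theorem comparison_of_jets (hn : 1 ≤ n) (hL : 0 ≤ L) {K K' : Set (E n)} (hK : IsCompact K)
    (hK' : IsCompact K') (hKK' : K ⊆ interior K') {U W : E n → ℝ}
    (hU : UpperSemicontinuousOn U K) (hW : LowerSemicontinuousOn W K') (hW0 : ∀ y ∈ K', 0 ≤ W y)
    {κ : ℝ} (hκ : 1 < κ)
    (hsub : ∀ x ∈ K, 0 < U x → ∀ p A, (∀ a b, ⟪A a, b⟫ = ⟪a, A b⟫) → IsSuperjet K U x p A →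
      ∀ b > 1, ∃ᶠ r in 𝓝[symDomain n] (p, formMatrix A), F n k L r < b)
    (hsup : ∀ y ∈ interior K', ∀ q A, (∀ a b, ⟪A a, b⟫ = ⟪a, A b⟫) →
      IsSuperjet K' (fun y => -W y) y (-q) (-A) →
      ∀ b < κ, ∃ᶠ r in 𝓝[symDomain n] (q, formMatrix A), b < F n k L r) :
    ∀ x ∈ K, U x ≤ W x := by
  intro x₀ hx₀
  by_contra! hlt
  have hx₀' : x₀ ∈ K' := interior_subset (hKK' hx₀)
  obtain ⟨xM, hxM, hmaxU⟩ := hU.exists_isMaxOn ⟨x₀, hx₀⟩ hK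
  set M : ℝ := U xM with hM
  have hUM : ∀ x ∈ K, U x ≤ M := fun x hx => hmaxU hx
  have hMpos : 0 < M := by linarith [hUM x₀ hx₀, hW0 x₀ hx₀']
  obtain ⟨ρ, hρ, hthick⟩ := hK.exists_thickening_subset_open isOpen_interior hKK'
  -- Each penalty alone exceeds `M`, the maximum of `U`, once its distance reaches `ρ / 4`.
  -- Positivity of `f` therefore keeps all three distances below `ρ / 4`.
  set α : ℝ := (M + 1) / (ρ / 4) ^ 4 with hα
  set c : ℝ := 2 * (M + 1) / (ρ / 4) ^ 2 with hc
  have hαpos : 0 < α := by positivity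
  have hcpos : 0 < c := by positivity
  have hWusc : UpperSemicontinuousOn (fun y => -W y) K' := fun x hx b hb =>
    (hW x hx (-b) (by linarith)).mono fun y hy => by linarith
  obtain ⟨V₁, s₁, hs₁, hV₁, hm₁⟩ := exists_supConvolution hK ⟨x₀, hx₀⟩ hU c
  obtain ⟨V₂, s₂, hs₂, hV₂, hm₂⟩ := exists_supConvolution hK' ⟨x₀, hx₀'⟩ hWusc c
  have hg₁ := supConvolution_hasSubgrads hs₁ hV₁ hm₁
  have hg₂ := supConvolution_hasSubgrads hs₂ hV₂ hm₂
  have hV₁c := hg₁.continuous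
  have hV₂c := hg₂.continuous
  set f : E n × E n → ℝ := fun z => V₁ z.1 + V₂ z.2 - α * ‖z.1 - z.2‖ ^ 4 with hf
  have hfc : Continuous f := by simp only [hf]; fun_prop
  have hest : ∀ z, 0 < f z → 0 < U (s₁ z.1) ∧ ‖z.1 - s₁ z.1‖ < ρ / 4 ∧
      ‖z.2 - s₂ z.2‖ < ρ / 4 ∧ ‖z.1 - z.2‖ < ρ / 4 := by
    intro z hz
    have a1 := hUM _ (hs₁ z.1)
    have a2 := hW0 _ (hs₂ z.2)
    have b1 : 0 ≤ c / 2 * ‖z.1 - s₁ z.1‖ ^ 2 := by positivity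
    have b2 : 0 ≤ c / 2 * ‖z.2 - s₂ z.2‖ ^ 2 := by positivity
    have b3 : 0 ≤ α * ‖z.1 - z.2‖ ^ 4 := by positivity
    simp only [hf, hV₁, hV₂] at hz
    have hc2 : c / 2 * (ρ / 4) ^ 2 = M + 1 := by rw [hc]; field_simp
    have hα2 : α * (ρ / 4) ^ 4 = M + 1 := by rw [hα]; field_simp
    refine ⟨by linarith, ?_, ?_, ?_⟩
    · by_contra! hge
      have : c / 2 * (ρ / 4) ^ 2 ≤ c / 2 * ‖z.1 - s₁ z.1‖ ^ 2 := by gcongr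
      linarith
    · by_contra! hge
      have : c / 2 * (ρ / 4) ^ 2 ≤ c / 2 * ‖z.2 - s₂ z.2‖ ^ 2 := by gcongr
      linarith
    · by_contra! hge
      have : α * (ρ / 4) ^ 4 ≤ α * ‖z.1 - z.2‖ ^ 4 := by gcongr
      linarith
  have hf0 : 0 < f (x₀, x₀) := by
    have a1 := hm₁ x₀ x₀ hx₀
    have a2 := hm₂ x₀ x₀ hx₀'
    simp only [sub_self, norm_zero] at a1 a2
    simp only [hf, sub_self, norm_zero]
    norm_num at a1 a2 ⊢
    linarith
  -- Points with `f` positive lie within `ρ / 4` of the compact sets, so a global maximum exists.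
  obtain ⟨⟨z₁, z₂⟩, hzmax⟩ := hfc.exists_forall_ge' (x₀, x₀) (by
    have hcomp := (hK.cthickening (r := ρ / 4)).prod (hK'.cthickening (r := ρ / 4))
    filter_upwards [hcomp.compl_mem_cocompact] with z hz
    by_contra! hlt'
    refine hz ?_
    obtain ⟨-, h1, h2, -⟩ := hest z (hf0.trans hlt')
    exact ⟨Metric.mem_cthickening_of_dist_le _ _ _ _ (hs₁ z.1) (by rw [dist_eq_norm]; exact h1.le),
      Metric.mem_cthickening_of_dist_le _ _ _ _ (hs₂ z.2) (by rw [dist_eq_norm]; exact h2.le)⟩)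
  have hfz : 0 < f (z₁, z₂) := hf0.trans_le (hzmax _)
  obtain ⟨r₀, hr₀, hfr₀⟩ := Metric.eventually_nhds_iff_ball.1
    (hfc.continuousAt.eventually (lt_mem_nhds hfz))
  -- consequences of the theorem on sums for a quadratic majorant of the penalisation
  have hkey : ∀ (p : E n) (C : ℝ), 0 ≤ C → (∀ᶠ ζ' in 𝓝 (z₁ - z₂), α * ‖ζ'‖ ^ 4 ≤
      α * ‖z₁ - z₂‖ ^ 4 + ⟪p, ζ' - (z₁ - z₂)⟫ + C / 2 * ‖ζ' - (z₁ - z₂)‖ ^ 2) →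
      ∀ δ > 0, ∀ ε > 0, ∃ r₁ r₂ : E n × Matrix (Fin n) (Fin n) ℝ, F n k L r₁ < 1 + ε ∧
        κ - ε < F n k L r₂ ∧ r₁.2.IsSymm ∧ r₂.2.IsSymm ∧ dist r₁.1 p < 2 * δ ∧
        dist r₂.1 p < 2 * δ ∧ (∀ i j, |r₂.2 i j| ≤ c + C + 2 * δ) ∧
        (∀ h : Fin n → ℝ, h ⬝ᵥ r₁.2.mulVec h ≤
          h ⬝ᵥ r₂.2.mulVec h + (2 * δ + 2 * n * δ) * (h ⬝ᵥ h)) ∧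
        (∀ h : Fin n → ℝ, 0 ≤ h ⬝ᵥ r₂.2.mulVec h + (δ + C + n * δ) * (h ⬝ᵥ h)) := by
    intro p C hC hmaj δ hδ ε hε
    have hloc : IsLocalMax (fun z : E n × E n => V₁ z.1 + V₂ z.2 - ⟪p, z.1 - z.2⟫
        - C / 2 * ‖z.1 - z.2 - (z₁ - z₂)‖ ^ 2) (z₁, z₂) := by
      have ht : Tendsto (fun z : E n × E n => z.1 - z.2) (𝓝 (z₁, z₂)) (𝓝 (z₁ - z₂)) :=
        Continuous.tendsto (by fun_prop) (z₁, z₂)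
      filter_upwards [ht.eventually hmaj] with z hz
      have := hzmax z
      simp only [hf] at this
      rw [inner_sub_right] at hz
      simp only [sub_self, norm_zero]
      norm_num
      linarith
    obtain ⟨ξ, η, p₁, p₂, A₁, A₂, hξ, hη, hp₁, hp₂, hA₁, hA₂, hA, hA₂up, hA₂low, he₁, he₂⟩ :=
      exists_expansions_near_max hcpos.le hC hg₁ hg₂ hloc (lt_min hδ hr₀)
    have hmin : min δ r₀ ≤ δ := min_le_left _ _
    have hmin0 : 0 < min δ r₀ := lt_min hδ hr₀
    have hfpos : 0 < f (ξ, η) := hfr₀ (ξ, η) (by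
      rw [Metric.mem_ball, Prod.dist_eq, max_lt_iff, dist_eq_norm, dist_eq_norm]
      exact ⟨hξ.trans_le (min_le_right _ _), hη.trans_le (min_le_right _ _)⟩)
    obtain ⟨hUpos, d1, d2, d3⟩ := hest _ hfpos
    -- Three steps of length below `ρ / 4` lead from `s₁ ξ ∈ K` to `s₂ η`, inside the `ρ`-thickening
    -- of `K`.
    have hyint : s₂ η ∈ interior K' := by
      refine hthick (Metric.mem_thickening_iff.2 ⟨s₁ ξ, hs₁ ξ, ?_⟩)
      rw [dist_eq_norm, show s₂ η - s₁ ξ = -(η - s₂ η) - (ξ - η) + (ξ - s₁ ξ) by abel]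
      calc _ ≤ ‖-(η - s₂ η) - (ξ - η)‖ + ‖ξ - s₁ ξ‖ := norm_add_le _ _
        _ ≤ ‖η - s₂ η‖ + ‖ξ - η‖ + ‖ξ - s₁ ξ‖ := by
          gcongr; rw [← norm_neg (η - s₂ η)]; exact norm_sub_le _ _
        _ < ρ := by simp only at d1 d2 d3; linarith
    have hj₁ := supConvolution_isSuperjet hV₁ hm₁ he₁
    have hj₂ := supConvolution_isSuperjet hV₂ hm₂ he₂
    have hA₂' : ∀ a b, ⟪(-A₂) a, b⟫ = ⟪a, (-A₂) b⟫ := by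
      intro a b; simp [hA₂]
    obtain ⟨r₁, hF₁, hsym₁, hd₁, hc₁⟩ := exists_near_of_frequently
      (hsub _ (hs₁ ξ) hUpos p₁ A₁ hA₁ hj₁ (1 + ε) (by linarith)) hδ
    obtain ⟨r₂, hF₂, hsym₂, hd₂, hc₂⟩ := exists_near_of_frequently
      (hsup _ hyint (-p₂) (-A₂) hA₂' (by rwa [neg_neg, neg_neg]) (κ - ε) (by linarith)) hδ
    simp only at hd₁ hc₁ hd₂ hc₂
    have hq₁ : ∀ h : Fin n → ℝ, |h ⬝ᵥ r₁.2.mulVec h - ⟪A₁ (WithLp.toLp 2 h), WithLp.toLp 2 h⟫| ≤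
        n * δ * (h ⬝ᵥ h) := by
      intro h
      have := abs_quadratic_sub_le hc₁ h
      rwa [dotProduct_formMatrix A₁ (WithLp.toLp 2 h)] at this
    have hq₂ : ∀ h : Fin n → ℝ, |h ⬝ᵥ r₂.2.mulVec h + ⟪A₂ (WithLp.toLp 2 h), WithLp.toLp 2 h⟫| ≤
        n * δ * (h ⬝ᵥ h) := by
      intro h
      have := abs_quadratic_sub_le hc₂ h
      rw [dotProduct_formMatrix (-A₂) (WithLp.toLp 2 h)] at this
      simpa using this
    refine ⟨r₁, r₂, hF₁, hF₂, hsym₁, hsym₂, ?_, ?_, ?_, ?_, ?_⟩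
    · calc dist r₁.1 p ≤ dist r₁.1 p₁ + dist p₁ p := dist_triangle _ _ _
        _ < 2 * δ := by rw [dist_eq_norm p₁]; linarith
    · calc dist r₂.1 p ≤ dist r₂.1 (-p₂) + dist (-p₂) p := dist_triangle _ _ _
        _ < 2 * δ := by
          rw [dist_eq_norm (-p₂), show -p₂ - p = -(p₂ + p) by abel, norm_neg]; linarith
    · intro i j
      have h1 := abs_formMatrix_le hA₂' (B := c + C + δ) (fun h => by
        have := hA₂low h
        simp only [_root_.neg_apply, inner_neg_left]
        nlinarith [sq_nonneg ‖h‖]) (fun h => by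
        have := hA₂up h
        simp only [_root_.neg_apply, inner_neg_left]
        nlinarith [sq_nonneg ‖h‖]) i j
      have h2 := hc₂ i j
      have h3 := abs_sub_abs_le_abs_sub (r₂.2 i j) (formMatrix (-A₂) i j)
      linarith
    · intro h
      have h1 := (abs_le.1 (hq₁ h)).2
      have h2 := (abs_le.1 (hq₂ h)).1
      have h3 := hA (WithLp.toLp 2 h)
      rw [← dotProduct_self_ofLp] at h3
      have h4 : 0 ≤ h ⬝ᵥ h := by rw [dotProduct_self_ofLp]; positivity
      have h5 := mul_le_mul_of_nonneg_right hmin h4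
      linarith
    · intro h
      have h2 := (abs_le.1 (hq₂ h)).1
      have h3 := hA₂up (WithLp.toLp 2 h)
      rw [← dotProduct_self_ofLp] at h3
      have h4 : 0 ≤ h ⬝ᵥ h := by rw [dotProduct_self_ofLp]; positivity
      have h5 := mul_le_mul_of_nonneg_right hmin h4
      linarith
  by_cases hζ : z₁ - z₂ = 0
  -- Zero slope: with `C = δ = t` the Hessian on the side of `W` is at least `-(n + 2) t`, so `F ≤ n
  -- L / (n L + 1) ≤ 1`. The choice `ε = κ - 1` gives `F > 1`.
  · set t : ℝ := 1 / ((n + 2) * (n * L + 1)) with ht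
    have htpos : 0 < t := by positivity
    obtain ⟨r₁, r₂, -, hF₂, -, hsym₂, -, -, -, -, hY⟩ := hkey 0 t htpos.le (by
      rw [hζ]
      filter_upwards [quartic_le_zero (n := n) α htpos] with ζ hζ'
      simpa using hζ') t htpos (κ - 1) (by linarith)
    have h1 := F_le_of_quadratic_ge (k := k) hn hL (q := r₂.1) hsym₂
      (show 0 ≤ t + t + n * t by positivity) hY
    have h2 : (t + t + n * t) * (n * L) ≤ 1 := by
      have e : t + t + n * t = 1 / (n * L + 1) := by rw [ht]; field_simp; ring
      rw [e, div_mul_eq_mul_div, one_mul, div_le_one (by positivity)]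
      linarith
    have h3 : κ - (κ - 1) < F n k L (r₂.1, r₂.2) := hF₂
    linarith
  · obtain ⟨C, hC, hmaj⟩ := quartic_le α hαpos.le (z₁ - z₂)
    have hp : (4 * α * ‖z₁ - z₂‖ ^ 2) • (z₁ - z₂) ≠ 0 := by
      have : ‖z₁ - z₂‖ ≠ 0 := norm_ne_zero_iff.2 hζ
      exact smul_ne_zero (by positivity) hζ
    -- Three errors of this size arise: one from each jet and one from almost monotonicity. Together
    -- they would give `κ < κ`.
    have hε : 0 < (κ - 1) / 3 := by linarith
    obtain ⟨δ, hδ, hmono⟩ := F_almost_monotone (k := k) hn hL hp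
      (show 0 ≤ c + C + 2 by positivity) hε
    set δ' : ℝ := min 1 (δ / (2 + 2 * n)) with hδ'
    have hδ'pos : 0 < δ' := by positivity
    have hδ'1 : δ' ≤ 1 := min_le_left _ _
    have hδ'δ : (2 + 2 * n) * δ' ≤ δ := by
      calc (2 + 2 * n) * δ' ≤ (2 + 2 * n) * (δ / (2 + 2 * n)) := by
            gcongr; exact min_le_right _ _
        _ = δ := by field_simp
    have hnn : (0 : ℝ) ≤ n * δ' := by positivity
    obtain ⟨r₁, r₂, hF₁, hF₂, hs1, hs2, hd₁, hd₂, hb, hXY, -⟩ := hkey _ C hC hmaj δ' hδ'pos _ hε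
    have h1 := hmono r₁.1 r₂.1 (by linarith) (by linarith) r₁.2 r₂.2 hs1 hs2
      (fun i j => (hb i j).trans (by linarith)) (fun h => (hXY h).trans (by
        have h4 : 0 ≤ h ⬝ᵥ h := by rw [dotProduct_self_ofLp]; positivity
        gcongr
        linarith)) (by
        have : κ - (κ - 1) / 3 < F n k L (r₂.1, r₂.2) := hF₂
        linarith)
    have h2 : F n k L (r₁.1, r₁.2) < 1 + (κ - 1) / 3 := hF₁
    have h3 : κ - (κ - 1) / 3 < F n k L (r₂.1, r₂.2) := hF₂
    linarith

end Core

/-! ### Nonnegativity and rescaling of supersolutions. -/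

section Final

open scoped RealInnerProductSpace
open Matrix

variable {n k : ℕ} {L : ℝ}

/-- A negative minimum may be tested with zero gradient and Hessian, on the boundary as well. Near
`(0, 0)` one has `|F| ≤ 1/4`, whereas the test requires values above `1/2`. -/
lemma supersolution_nonneg (hn : 1 ≤ n) (hL : 0 ≤ L) {K : Set (E n)} (hK : IsCompact K)
    {w : E n → ℝ} (hw : LowerSemicontinuousOn w K) (hsup : IsViscSupersolution k L K w)
    (hbd : SuperZeroBoundary k L K w) : ∀ x ∈ K, 0 ≤ w x := by
  intro x hx
  by_contra! hlt
  obtain ⟨x₀, hx₀, hmin⟩ := hw.exists_isMinOn ⟨x, hx⟩ hK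
  have hneg : w x₀ < 0 := (hmin hx).trans_lt hlt
  have htest : SuperTestAt k L K w x₀ := by
    by_cases hint : x₀ ∈ interior K
    · exact hsup.2 x₀ hint
    · exact hbd x₀ ⟨subset_closure hx₀, hint⟩ (by rwa [lowerEnv_eq_self hw hx₀])
  have h0 := htest.frequently_gt hn hL hK hw (fun y hy => hmin hy) hx₀ (q := 0) (A := 0)
    (by simp) (by
      intro c hc
      filter_upwards [self_mem_nhdsWithin] with y hy
      have h1 : w x₀ ≤ w y := hmin hy
      have h2 : 0 ≤ c * ‖y - x₀‖ ^ 2 := by positivity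
      simp
      linarith) (b := 1 / 2) (by norm_num)
  have h1 := eventually_nhdsWithin_of_eventually_nhds (s := symDomain n)
    (eventually_abs_F_le (k := k) hn hL ((0 : E n), formMatrix (0 : E n →L[ℝ] E n))
      (show (0 : ℝ) < 1 / 4 by norm_num))
  obtain ⟨r, hr1, hr2⟩ := (h0.and_eventually h1).exists
  have h3 := (abs_le.1 hr2).2
  simp [formMatrix] at h3
  linarith

lemma sum_smul_single (x : E n) : ∑ i, x i • EuclideanSpace.single i (1 : ℝ) = x := by
  simpa using (EuclideanSpace.basisFun (Fin n) ℝ).sum_repr x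

lemma inner_single_one (x : E n) (i : Fin n) : ⟪EuclideanSpace.single i (1 : ℝ), x⟫ = x i := by
  rw [EuclideanSpace.inner_single_left, map_one, one_mul]

/-- The matrix of a linear isometry in the standard basis. -/
def isometryMatrix (R : E n ≃ₗᵢ[ℝ] E n) : Matrix (Fin n) (Fin n) ℝ :=
  Matrix.of fun i j => R (EuclideanSpace.single j 1) i

lemma isometryMatrix_mulVec (R : E n ≃ₗᵢ[ℝ] E n) (x : E n) :
    isometryMatrix R *ᵥ x.ofLp = (R x).ofLp := by
  ext i
  conv_rhs => rw [← sum_smul_single x]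
  simp [isometryMatrix, mulVec, dotProduct, mul_comm]

lemma isometryMatrix_transpose_mulVec (R : E n ≃ₗᵢ[ℝ] E n) (x : E n) :
    (isometryMatrix R)ᵀ *ᵥ x.ofLp = (R.symm x).ofLp := by
  ext i
  rw [← inner_single_one (R.symm x) i, ← R.inner_map_map, R.apply_symm_apply]
  simp [isometryMatrix, mulVec, dotProduct, PiLp.inner_apply, mul_comm]

lemma matrix_ext_of_mulVec {A B : Matrix (Fin n) (Fin n) ℝ}
    (h : ∀ x : E n, A *ᵥ x.ofLp = B *ᵥ x.ofLp) : A = B :=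
  ext_of_mulVec_single fun i => h (WithLp.toLp 2 (Pi.single i 1))

lemma isometryMatrix_orthogonal (R : E n ≃ₗᵢ[ℝ] E n) :
    (isometryMatrix R)ᵀ * isometryMatrix R = 1 :=
  matrix_ext_of_mulVec fun x => by
    rw [← mulVec_mulVec, isometryMatrix_mulVec, isometryMatrix_transpose_mulVec,
      R.symm_apply_apply, one_mulVec]

lemma formMatrix_mulVec {A : E n →L[ℝ] E n} (hA : ∀ a b, ⟪A a, b⟫ = ⟪a, A b⟫) (x : E n) :
    formMatrix A *ᵥ x.ofLp = (A x).ofLp := by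
  ext i
  rw [← inner_single_one (A x) i, ← hA]
  conv_rhs => rw [← sum_smul_single x]
  simp only [formMatrix, mulVec, dotProduct, Matrix.of_apply, inner_sum, real_inner_smul_right]
  exact Finset.sum_congr rfl fun j _ => mul_comm _ _

/-- The supersolution property, in terms of jets, of a rescaled and rotated supersolution. -/
lemma frequently_gt_of_similarity (hn : 1 ≤ n) (hL : 0 ≤ L) {K : Set (E n)} (hK : IsCompact K)
    {w : E n → ℝ} (hw : LowerSemicontinuousOn w K) {m : ℝ} (hm : ∀ y ∈ K, m ≤ w y)
    (R : E n ≃ₗᵢ[ℝ] E n) {c κ : ℝ} (hc : 0 < c) (hκ : 0 < κ) {T S : E n → E n} {b₀ : E n}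
    (hT : ∀ x, T x = c • R x + b₀) (hST : ∀ x, S (T x) = x) {W : E n → ℝ}
    (hW : ∀ y, W y = κ * c ^ 2 * w (S y)) {x : E n} (hx : x ∈ K) (ht : SuperTestAt k L K w x)
    {q : E n} {A : E n →L[ℝ] E n} (hA : ∀ a b, ⟪A a, b⟫ = ⟪a, A b⟫)
    (hj : IsSuperjet (T '' K) (fun y => -W y) (T x) (-q) (-A)) {b : ℝ} (hb : b < κ) :
    ∃ᶠ r in 𝓝[symDomain n] (q, formMatrix A), b < F n k L r := by
  -- Since `W ∘ T = κ c² w`, the chain rule pulls `(q, A)` back to `((κ c)⁻¹ R⁻¹ q, κ⁻¹ R⁻¹ A R)`.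
  -- The map `G` below inverts this, and by `F_conj` it multiplies `F` by `κ`.
  set B : E n →L[ℝ] E n := κ⁻¹ • ((R.symm.toContinuousLinearEquiv : E n →L[ℝ] E n).comp
    (A.comp (R.toContinuousLinearEquiv : E n →L[ℝ] E n))) with hB
  have hBapp : ∀ a, B a = κ⁻¹ • R.symm (A (R a)) := fun a => rfl
  have hBin : ∀ a b, ⟪B a, b⟫ = κ⁻¹ * ⟪A (R a), R b⟫ := by
    intro a b
    rw [hBapp, real_inner_smul_left, ← R.inner_map_map, R.apply_symm_apply]
  have hBs : ∀ a b, ⟪B a, b⟫ = ⟪a, B b⟫ := by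
    intro a b
    rw [hBin, real_inner_comm (B b) a, hBin, hA, real_inner_comm]
  set q' : E n := (κ * c)⁻¹ • R.symm q with hq'
  have hTc : Continuous T := by
    rw [show T = fun x => c • R x + b₀ from funext hT]
    fun_prop
  have hjet : IsSuperjet K (fun y => -w y) x (-q') (-B) := by
    intro ε hε
    have h1 := hj (κ * ε) (by positivity)
    have htend : Tendsto T (𝓝[K] x) (𝓝[T '' K] (T x)) :=
      hTc.continuousWithinAt.tendsto_nhdsWithin (mapsTo_image T K)
    filter_upwards [htend.eventually h1] with y hy
    have e1 : T y - T x = c • R (y - x) := by rw [hT, hT, map_sub]; module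
    rw [e1] at hy
    simp only [hW, hST] at hy
    have e2 : ⟪q', y - x⟫ = (κ * c)⁻¹ * ⟪q, R (y - x)⟫ := by
      rw [hq', real_inner_smul_left, ← R.inner_map_map, R.apply_symm_apply]
    simp only [_root_.neg_apply, inner_neg_left, map_smul, real_inner_smul_left,
      real_inner_smul_right, norm_smul, R.norm_map, Real.norm_eq_abs, mul_pow, sq_abs] at hy ⊢
    rw [e2, hBin]
    have hpos : 0 < κ * c ^ 2 := by positivity
    refine le_of_mul_le_mul_left ?_ hpos
    have e3 : κ * c ^ 2 * (-w x + -((κ * c)⁻¹ * ⟪q, R (y - x)⟫)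
        + 1 / 2 * -(κ⁻¹ * ⟪A (R (y - x)), R (y - x)⟫) + ε * ‖y - x‖ ^ 2) =
        -(κ * c ^ 2 * w x) + -(c * ⟪q, R (y - x)⟫)
        + 1 / 2 * -(c * (c * ⟪A (R (y - x)), R (y - x)⟫)) + κ * ε * (c ^ 2 * ‖y - x‖ ^ 2) := by
      field_simp
    rw [e3]
    linarith
  have hfreq := ht.frequently_gt hn hL hK hw hm hx hBs hjet (b := b / κ)
    (by rwa [div_lt_one hκ])
  set O := isometryMatrix R with hO
  have hOO : Oᵀ * O = 1 := isometryMatrix_orthogonal R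
  set G : E n × Matrix (Fin n) (Fin n) ℝ → E n × Matrix (Fin n) (Fin n) ℝ :=
    fun r => ((κ * c) • R r.1, κ • (O * r.2 * Oᵀ)) with hG
  have hGc : Continuous G := by
    refine Continuous.prodMk (by fun_prop) ?_
    exact ((continuous_const.matrix_mul continuous_snd).matrix_mul continuous_const).const_smul κ
  have hGs : MapsTo G (symDomain n) (symDomain n) := by
    intro r hr
    have hr' : r.2.IsSymm := hr
    change (κ • (O * r.2 * Oᵀ)).IsSymm
    rw [IsSymm, transpose_smul, transpose_mul, transpose_mul, transpose_transpose, hr'.eq,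
      mul_assoc]
  have hGq : G (q', formMatrix B) = (q, formMatrix A) := by
    refine Prod.ext ?_ ?_
    · simp only [hG, hq', map_smul, R.apply_symm_apply, smul_smul]
      rw [mul_inv_cancel₀ (by positivity), one_smul]
    · refine matrix_ext_of_mulVec fun y => ?_
      simp only [hG]
      rw [smul_mulVec, ← mulVec_mulVec, ← mulVec_mulVec, isometryMatrix_transpose_mulVec,
        formMatrix_mulVec hBs, isometryMatrix_mulVec, formMatrix_mulVec hA, hBapp, map_smul,
        R.apply_symm_apply, R.apply_symm_apply, WithLp.ofLp_smul, smul_smul,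
        mul_inv_cancel₀ hκ.ne', one_smul]
  have htend : Tendsto G (𝓝[symDomain n] (q', formMatrix B))
      (𝓝[symDomain n] (q, formMatrix A)) := by
    rw [← hGq]
    exact hGc.continuousWithinAt.tendsto_nhdsWithin hGs
  refine htend.frequently (hfreq.mono fun r hr => ?_)
  have hF : F n k L (G r) = κ * F n k L (r.1, r.2) := by
    refine F_conj hOO hκ.le (show κ * c ≠ 0 by positivity) ?_ r.2
    rw [WithLp.ofLp_smul, mulVec_smul, isometryMatrix_transpose_mulVec, R.symm_apply_apply]
  rw [hF]
  rw [div_lt_iff₀ hκ] at hr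
  linarith

/-- Comparison of `u` with a rescaled copy of `w`. -/
lemma le_rescaled (hn : 1 ≤ n) (hL : 0 ≤ L) {K : Set (E n)} (hK : IsCompact K) {T : E n → E n}
    (R : E n ≃ₗᵢ[ℝ] E n) {c : ℝ} {b₀ : E n} (hc : 0 < c) (hT : ∀ x, T x = c • R x + b₀)
    (hKT : K ⊆ interior (T '' K)) {u w : E n → ℝ} (hu_usc : UpperSemicontinuousOn u K)
    (hu_sub : IsViscSubsolution k L K u) (hu_bdry : SubZeroBoundary k L K u)
    (hw_lsc : LowerSemicontinuousOn w K) (hw_super : IsViscSupersolution k L K w)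
    (hw_bdry : SuperZeroBoundary k L K w) {κ : ℝ} (hκ : 1 < κ) {x : E n} (hx : T x ∈ K) :
    u (T x) ≤ κ * c ^ 2 * w x := by
  have hw0 := supersolution_nonneg hn hL hK hw_lsc hw_super hw_bdry
  have hκ0 : 0 < κ := one_pos.trans hκ
  have hpos : 0 < κ * c ^ 2 := by positivity
  set S : E n → E n := fun y => c⁻¹ • R.symm (y - b₀) with hS
  have hST : ∀ x, S (T x) = x := by
    intro x
    simp only [hS, hT, add_sub_cancel_right, map_smul, R.symm_apply_apply, smul_smul]
    rw [inv_mul_cancel₀ hc.ne', one_smul]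
  have hTc : Continuous T := by
    rw [show T = fun x => c • R x + b₀ from funext hT]
    fun_prop
  have hSc : Continuous S := by simp only [hS]; fun_prop
  have hSK : MapsTo S (T '' K) K := by
    rintro _ ⟨y, hy, rfl⟩
    rwa [hST]
  obtain ⟨M, hM⟩ := hu_sub.1
  have hcomp := comparison_of_jets (k := k) hn hL hK (hK.image hTc) hKT hu_usc
    (W := fun y => κ * c ^ 2 * w (S y)) (by
      have h1 : LowerSemicontinuousOn (w ∘ S) (T '' K) := hw_lsc.comp hSc.continuousOn hSK
      intro y hy a ha
      have hya : a / (κ * c ^ 2) < (w ∘ S) y := (div_lt_iff₀' hpos).2 ha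
      filter_upwards [h1 y hy _ hya] with z hz
      exact (div_lt_iff₀' hpos).1 hz)
    (fun y hy => mul_nonneg hpos.le (hw0 _ (hSK hy))) hκ
    (by
      intro x hx hux p A hA hj b hb
      refine SubTestAt.frequently_lt hn hL hK hu_usc (fun y hy => (abs_le.1 (hM y hy)).2) hx ?_
        hA hj hb
      by_cases hint : x ∈ interior K
      · exact hu_sub.2 x hint
      · exact hu_bdry x ⟨subset_closure hx, hint⟩ (by rwa [upperEnv_eq_self hu_usc hx]))
    (by
      intro y hy q A hA hj b hb
      obtain ⟨x, hx, rfl⟩ := interior_subset hy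
      -- Interior points of `T(K)` come from interior points of `K`, so the supersolution needs no
      -- boundary test here.
      have hxint : x ∈ interior K := by
        refine mem_interior.2 ⟨T ⁻¹' interior (T '' K), ?_, isOpen_interior.preimage hTc, hy⟩
        intro z hz
        have := hSK (interior_subset hz)
        rwa [hST] at this
      exact frequently_gt_of_similarity hn hL hK hw_lsc hw0 R hc hκ0 hT hST (fun _ => rfl) hx
        (hw_super.2 x hxint) hA hj hb)
    (T x) hx
  simpa only [hST] using hcomp

end Final

end ViscComparison

end

/-! ### The limit `ι ↓ 1`. -/

theorem theorem4p3 (n k : ℕ) (L : ℝ) (hn : 2 ≤ n) (hk : 1 ≤ k) (hkn : k ≤ n - 1) (hL : 1 ≤ L)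
    (K : Set (ViscComparison.E n)) (hK : IsCompact K)
    (T : ℝ → ViscComparison.E n → ViscComparison.E n)
    (hT : ∀ ι ∈ Set.Ioc (1 : ℝ) 2, ViscComparison.IsRotDilTrans (T ι))
    (hKT : ∀ ι ∈ Set.Ioc (1 : ℝ) 2, K ⊆ interior (T ι '' K))
    (hlim : ∀ x, Filter.Tendsto (fun ι => T ι x) (nhdsWithin 1 (Set.Ioi 1)) (nhds x))
    (u w : ViscComparison.E n → ℝ)
    (hu_usc : UpperSemicontinuousOn u K)
    (hu_sub : ViscComparison.IsViscSubsolution k L K u)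
    (hu_bdry : ViscComparison.SubZeroBoundary k L K u)
    (hw_lsc : LowerSemicontinuousOn w K)
    (hw_super : ViscComparison.IsViscSupersolution k L K w)
    (hw_bdry : ViscComparison.SuperZeroBoundary k L K w) :
    ∀ x ∈ K, u x ≤ ViscComparison.upperEnv K w x := by
  intro x hx
  have hn1 : 1 ≤ n := by omega
  have hL0 : 0 ≤ L := by linarith
  have hw0 := ViscComparison.supersolution_nonneg hn1 hL0 hK hw_lsc hw_super hw_bdry
  have : (𝓝[K] x).NeBot := nhdsWithin_neBot_of_mem hx
  obtain ⟨C, hC⟩ := hw_super.1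
  have hbdd : IsBoundedUnder (· ≤ ·) (𝓝[K] x) w :=
    isBoundedUnder_of_eventually_le (a := C) (by
      filter_upwards [self_mem_nhdsWithin] with y hy using (abs_le.1 (hC y hy)).2)
  have hge : 0 ≤ ViscComparison.upperEnv K w x :=
    le_limsup_of_frequently_le (Eventually.frequently (by
      filter_upwards [self_mem_nhdsWithin] with y hy using hw0 y hy)) hbdd
  refine le_of_forall_gt_imp_ge_of_dense fun r hr => ?_
  have hr0 : 0 < r := hge.trans_lt hr
  have hev : ∀ᶠ y in 𝓝[K] x, w y < r := eventually_lt_of_limsup_lt hr hbdd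
  choose! R c b _hdet hc hTe using hT
  have hIoc : Set.Ioc (1 : ℝ) 2 ∈ 𝓝[>] (1 : ℝ) := Ioc_mem_nhdsGT (by norm_num)
  have hdist : ∀ ι ∈ Set.Ioc (1 : ℝ) 2, ∀ y z, ‖T ι y - T ι z‖ = c ι * ‖y - z‖ := by
    intro ι hι y z
    rw [hTe ι hι, hTe ι hι, add_sub_add_right_eq_sub, ← smul_sub, ← map_sub, norm_smul,
      LinearIsometryEquiv.norm_map, Real.norm_eq_abs, abs_of_pos (hc ι hι)]
  -- the dilation factors tend to one
  have hclim : Tendsto c (𝓝[>] 1) (𝓝 1) := by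
    set e : ViscComparison.E n := EuclideanSpace.single ⟨0, by omega⟩ 1 with he
    have hne : ‖e - 0‖ = 1 := by simp [he]
    have h1 := ((hlim e).sub (hlim 0)).norm
    rw [hne] at h1
    refine h1.congr' ?_
    filter_upwards [hIoc] with ι hι
    rw [hdist ι hι, hne, mul_one]
  -- the preimages of `x`
  have hpre : ∀ ι ∈ Set.Ioc (1 : ℝ) 2, ∃ y ∈ K, T ι y = x := by
    intro ι hι
    have h1 : x ∈ T ι '' K := interior_subset (hKT ι hι hx)
    exact h1
  choose! y hyK hy using hpre
  have hylim : Tendsto y (𝓝[>] 1) (𝓝[K] x) := by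
    refine tendsto_nhdsWithin_iff.2 ⟨?_, by filter_upwards [hIoc] with ι hι using hyK ι hι⟩
    rw [tendsto_iff_norm_sub_tendsto_zero]
    have h1 := (((hlim x).sub_const x).norm).mul (hclim.inv₀ one_ne_zero)
    rw [sub_self, norm_zero, zero_mul] at h1
    refine h1.congr' ?_
    filter_upwards [hIoc] with ι hι
    have h2 := hdist ι hι x (y ι)
    rw [hy ι hι] at h2
    rw [h2, norm_sub_rev x]
    have := (hc ι hι).ne'
    field_simp
  have hlim2 : Tendsto (fun ι => ι * c ι ^ 2 * r) (𝓝[>] 1) (𝓝 (1 * 1 ^ 2 * r)) :=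
    ((tendsto_id.mono_left nhdsWithin_le_nhds).mul (hclim.pow 2)).mul_const r
  rw [one_pow, one_mul, one_mul] at hlim2
  -- For `ι` near `1`, `w (y ι) < r` because `y ι → x` inside `K`, so `u x ≤ ι c² w (y ι) ≤ ι c² r`,
  -- and the right-hand side tends to `r`.
  refine ge_of_tendsto hlim2 ?_
  filter_upwards [hIoc, hylim.eventually hev] with ι hι hwr
  have h1 := ViscComparison.le_rescaled (k := k) hn1 hL0 hK (R ι) (hc ι hι) (hTe ι hι) (hKT ι hι)
    hu_usc hu_sub hu_bdry hw_lsc hw_super hw_bdry hι.1 (x := y ι) (by rwa [hy ι hι])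
  rw [hy ι hι] at h1
  refine h1.trans (mul_le_mul_of_nonneg_left hwr.le ?_)
  have := hι.1
  positivity
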